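/- For a word $w$ of distinct positive integers, define the stack-sorting map $s$ recursively by $s(\varepsilon)=\varepsilon$ for the empty word $\varepsilon$ and $s(LmR)=s(L)\,s(R)\,m$, where $m$ is the largest entry of $w=LmR$. Let $\mathcal W_2(n)$ be the set of $2$-stack-sortable permutations in $S_n$, that is, of those $\pi=\pi_1\cdots\pi_n\in S_n$ for which $s(s(\pi))$ is increasing. For $\pi\in S_n$, let $\operatorname{tl}(\pi)$ be the largest $\ell\in\{0,\ldots,n\}$ such that $\pi_i=i$ for all $i\in\{n-\ell+1,\ldots,n\}$, and let $\operatorname{leg}(\pi)$ be the number of $a\in\{0,\ldots,n\}$ for which there are no indices $i_1<i_2<i_3$ with $\pi_{i_3}\le a<\pi_{i_1}<\pi_{i_2}$. Let $$J(t,u,v)=\sum_{n\ge 1}\ \sum_{\pi\in\mathcal W_2(n)}|s^{-1}(\pi)|\,t^n u^{\operatorname{leg}(\pi)-1}v^{\operatorname{tl}(\pi)}\in\mathbb Z[u,v][[t]],$$ and let $C(x)=\sum_{n\ge 0}\frac{1}{n+1}\binom{2n}{n}x^n$ be the generating function of the Catalan numbers. **Theorem.** In the field of fractions of $\mathbb Z[u,v][[t]]$,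 $$J(t,u,v)=(C(tuv)-1)\bigl(1+tuJ(t,u,1)\bigr)+\frac{tuv}{1-u}\left(\frac{J(t,u,1)-J(t,u,v)}{1-v}-\frac{C(tuv)-1}{v}\right)\left(\frac{J(t,1,1)-uvJ(t,1,uv)}{1-uv}-u\,\frac{J(t,u,1)-vJ(t,u,v)}{1-v}\right).$$ -/

import Mathlib

/-! ### Permutations in one-line notation and the stack-sorting map

A permutation is the list of its (distinct) entries. -/

/-- The largest entry of a list of natural numbers (`0` for the empty list). -/
def maxEntry (w : List ℕ) : ℕ := w.foldr max 0

theorem maxEntry_mem : ∀ {w : List ℕ}, w ≠ [] → maxEntry w ∈ w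
  | [], h => absurd rfl h
  | [_], _ => by simp [maxEntry]
  | a :: b :: l, _ => by
    have ih : maxEntry (b :: l) ∈ b :: l := maxEntry_mem (by simp)
    have h : maxEntry (a :: b :: l) = max a (maxEntry (b :: l)) := rfl
    rw [h]
    rcases max_choice a (maxEntry (b :: l)) with h | h <;> rw [h]
    · simp
    · exact List.mem_cons_of_mem _ ih

/-- The stack-sorting map: the empty permutation is sent to itself, and `L m R`, with `m` the
largest entry, is sent to `s(L) s(R) m`. -/
def stackSort (w : List ℕ) : List ℕ :=
  if h : w = [] then []
  else
    stackSort (w.take (w.idxOf (maxEntry w))) ++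
      stackSort (w.drop (w.idxOf (maxEntry w) + 1)) ++ [maxEntry w]
termination_by w.length
decreasing_by
  · have := List.idxOf_lt_length_of_mem (maxEntry_mem h)
    simp only [List.length_take]
    omega
  · have := List.length_pos_of_ne_nil h
    simp only [List.length_drop]
    omega

/-- Stack-sorting only rearranges the entries. -/
theorem stackSort_perm (w : List ℕ) : (stackSort w).Perm w := by
  induction hn : w.length using Nat.strong_induction_on generalizing w with
  | _ n ih =>
    rw [stackSort]
    split_ifs with h
    · rw [h]
    · have hi := List.idxOf_lt_length_of_mem (maxEntry_mem h)
      have h1 := ih (w.take (w.idxOf (maxEntry w))).length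
        (by simp only [List.length_take]; omega) _ rfl
      have h2 := ih (w.drop (w.idxOf (maxEntry w) + 1)).length
        (by simp only [List.length_drop]; omega) _ rfl
      have h3 : w.take (w.idxOf (maxEntry w)) ++
          (maxEntry w :: w.drop (w.idxOf (maxEntry w) + 1)) = w := by
        conv_rhs => rw [← List.take_append_drop (w.idxOf (maxEntry w)) w,
          List.drop_eq_getElem_cons hi, List.getElem_idxOf hi]
      conv_rhs => rw [← h3]
      exact ((h1.append h2).append_right _).trans
        (by simpa using List.Perm.append_left _ (List.perm_append_singleton _ _))

/-- `S_n`: the permutations of `{1, …, n}`. -/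
def permsOf (n : ℕ) : Finset (List ℕ) := (List.range' 1 n).permutations.toFinset

/-- `𝓦_k(n)`: the `k`-stack-sortable permutations in `S_n`. -/
def stackSortable (k n : ℕ) : Finset (List ℕ) :=
  (permsOf n).filter fun π => (stackSort^[k] π).Pairwise (· < ·)

/-- The fibre `s⁻¹(π)`. -/
def sortPreimage (π : List ℕ) : Finset (List ℕ) :=
  π.permutations.toFinset.filter fun σ => stackSort σ = π

/-- `sortPreimage π` is the whole fibre of the stack-sorting map. -/
theorem mem_sortPreimage {π σ : List ℕ} : σ ∈ sortPreimage π ↔ stackSort σ = π := by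
  simp only [sortPreimage, Finset.mem_filter, List.mem_toFinset, List.mem_permutations,
    and_iff_right_iff_imp]
  rintro rfl
  exact (stackSort_perm σ).symm

/-! ### The two statistics

Lists are indexed from `0`, so the entry `π_i` is `π[i - 1]`. -/

/-- The tail length of `π ∈ S_n`: the largest `ℓ ∈ {0, …, n}` such that `π_i = i` for all
`i ∈ {n - ℓ + 1, …, n}`. -/
def tailLength (π : List ℕ) : ℕ :=
  Nat.findGreatest
    (fun ℓ => ∀ i : Fin π.length, π.length - ℓ ≤ (i : ℕ) → π[i] = (i : ℕ) + 1) π.length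

/-- The interval `(a, a + 1)` is a legal space for `π`: there are no `i₁ < i₂ < i₃` with
`π_{i₃} ≤ a < π_{i₁} < π_{i₂}`. -/
def IsLegalSpace (π : List ℕ) (a : ℕ) : Prop :=
  ¬ ∃ i₁ i₂ i₃ : Fin π.length, i₁ < i₂ ∧ i₂ < i₃ ∧ π[i₃] ≤ a ∧ a < π[i₁] ∧ π[i₁] < π[i₂]

instance (π : List ℕ) : DecidablePred (IsLegalSpace π) :=
  fun a => by unfold IsLegalSpace; infer_instance

/-- `leg(π)`: the number of `a ∈ {0, …, n}` such that `(a, a + 1)` is a legal space for `π`. -/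
def leg (π : List ℕ) : ℕ := ((Finset.range (π.length + 1)).filter (IsLegalSpace π)).card

/-! ### Generating functions -/

/-- The coefficient of `t ^ n` in `J(t, a, b)`, for `a`, `b` in any commutative ring. -/
def coeffJ {A : Type*} [CommRing A] (a b : A) (n : ℕ) : A :=
  ∑ π ∈ stackSortable 2 n, ((sortPreimage π).card : A) * a ^ (leg π - 1) * b ^ tailLength π

/-- The power series `J(t, a, b) = ∑_{n ≥ 1} ∑_{π ∈ 𝓦₂(n)} |s⁻¹(π)| t^n a^(leg π - 1) b^(tl π)`
in `t`. -/
noncomputable def seriesJ {A : Type*} [CommRing A] (a b : A) : PowerSeries A :=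
  PowerSeries.mk fun n => if n = 0 then 0 else coeffJ a b n

/-- `J(t, f a, f b)` is obtained from `J(t, a, b)` by applying the ring homomorphism `f` to the
coefficients; in particular every `J(t, a, b)` is a specialisation of the generic `J(t, u, v)`
over `ℤ[u, v]`. -/
theorem map_seriesJ {A B : Type*} [CommRing A] [CommRing B] (f : A →+* B) (a b : A) :
    PowerSeries.map f (seriesJ a b) = seriesJ (f a) (f b) := by
  ext n
  by_cases h : n = 0 <;> simp [seriesJ, coeffJ, h]

/-- The power series `C(a t) = ∑_{n ≥ 0} C_n a^n t^n` in `t`, with `C_n` the Catalan numbers. -/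
noncomputable def catalanGF {A : Type*} [CommRing A] (a : A) : PowerSeries A :=
  PowerSeries.mk fun n => (catalan n : A) * a ^ n

/-- `ℤ[u, v]`, where `u = X 0` and `v = X 1`. -/
abbrev PolyUV : Type := MvPolynomial (Fin 2) ℤ

/-- `ℤ[u, v][[t]]`. -/
abbrev SeriesTUV : Type := PowerSeries PolyUV

/-- The field of fractions of `ℤ[u, v][[t]]`. -/
abbrev FieldTUV : Type := FractionRing SeriesTUV

/-- The inclusion of `ℤ[u, v][[t]]` in its field of fractions. -/
noncomputable abbrev toField : SeriesTUV →+* FieldTUV := algebraMap SeriesTUV FieldTUV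

/-- The indeterminate `u` of `ℤ[u, v]`. -/
noncomputable abbrev polyU : PolyUV := MvPolynomial.X 0

/-- The indeterminate `v` of `ℤ[u, v]`. -/
noncomputable abbrev polyV : PolyUV := MvPolynomial.X 1

/-- `t` as an element of the field. -/
noncomputable abbrev tt : FieldTUV := toField PowerSeries.X

/-- `u` as an element of the field. -/
noncomputable abbrev uu : FieldTUV := toField (PowerSeries.C polyU)

/-- `v` as an element of the field. -/
noncomputable abbrev vv : FieldTUV := toField (PowerSeries.C polyV)

/-- `J(t, a, b)` as an element of the field, for `a, b ∈ ℤ[u, v]`. -/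
noncomputable abbrev JJ (a b : PolyUV) : FieldTUV := toField (seriesJ a b)

/-- `C(tuv)` as an element of the field. -/
noncomputable abbrev Ctuv : FieldTUV := toField (catalanGF (polyU * polyV))

/-! ### The stack-sorting map -/

/-! The equation is a weighted decomposition of 2-stack-sortable permutations at their largest
entry, once the maximal tail is split off.

Fibres. For a word `w`, let `tailSeries w` be the series in x whose coefficient of x^k is the size
of the fibre over `w` followed by k larger entries in increasing order. A preimage of w m, with m
largest, is a cut of w together with preimages of its two pieces. This recursion gives the product
formula T(P m Q) = x T(P m) T(Q) for nonempty Q with all entries of P and Q below m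
(`tailSeries_append_cons`). So a tail of length l behind P m Q is shared out as i + k = l, with a
tail of length i ≥ 1 for P and one of length k for Q (`tailCount_append_cons`).

Structure. By Knuth's criterion, π is 2-stack-sortable iff s(π) avoids 231. Write π = P m Q with m
largest and Q nonempty, so that s(π) = s(P) s(Q) m. As s(P) ends in its maximum M, avoidance means
that s(P) and s(Q) avoid 231, that the entries of P other than M lie below those of Q, and that M is
inserted among the values of Q at a legal space b of Q (`avoids231_stackSort_mergeAt`). Hence
`mergeAt` is a bijection onto the permutations of tail length 0 and positive size, with b = 0 forced
when P is empty. The merged permutation has leg P + #{legal spaces of Q above b} + 1 legal spaces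
(`leg_mergeAt`), so summing over b gives 1 + u + ... + u^(leg Q - 1).

Series. Pairs (P, i) amount to permutations with a marked tail of length i. Summing the geometric
progressions in i and in the legal spaces yields the quotients by 1 - v, 1 - uv and 1 - u. With A,
G, B for the series of `markedTail`, `markedTail₀`, `markedTailLegal` and D for the part of A with P
empty, so that vD = C - 1, the decomposition reads J = C - 1 + tuv((A - D)(B - C) + D(G - C)), where
C is C(tuv) (`seriesJ_eq`). The theorem follows by algebra. -/

theorem le_maxEntry {w : List ℕ} {x : ℕ} (hx : x ∈ w) : x ≤ maxEntry w := by
  induction w with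
  | nil => simp at hx
  | cons a w ih =>
    have h : maxEntry (a :: w) = max a (maxEntry w) := rfl
    rw [h]
    rcases List.mem_cons.1 hx with rfl | hx
    · exact le_max_left _ _
    · exact (ih hx).trans (le_max_right _ _)

theorem maxEntry_eq {w : List ℕ} {m : ℕ} (hm : m ∈ w) (h : ∀ x ∈ w, x ≤ m) : maxEntry w = m :=
  le_antisymm (h _ (maxEntry_mem (List.ne_nil_of_mem hm))) (le_maxEntry hm)

@[simp]
theorem stackSort_nil : stackSort [] = [] := by
  rw [stackSort]; simp

theorem stackSort_append_cons {L R : List ℕ} {m : ℕ} (hL : ∀ x ∈ L, x < m) (hR : ∀ x ∈ R, x < m) :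
    stackSort (L ++ m :: R) = stackSort L ++ stackSort R ++ [m] := by
  have hmax : maxEntry (L ++ m :: R) = m := by
    refine maxEntry_eq (by simp) fun x hx => ?_
    rcases List.mem_append.1 hx with hx | hx
    · exact (hL x hx).le
    · rcases List.mem_cons.1 hx with rfl | hx
      · exact le_rfl
      · exact (hR x hx).le
  have hidx : (L ++ m :: R).idxOf m = L.length := by
    rw [List.idxOf_append_of_notMem fun h => (hL m h).false]
    simp
  rw [stackSort, dif_neg (by simp), hmax, hidx]
  simp

theorem exists_eq_append_cons_maxEntry {w : List ℕ} (h : w ≠ []) (hd : w.Nodup) :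
    ∃ L R, w = L ++ maxEntry w :: R ∧ (∀ x ∈ L, x < maxEntry w) ∧ ∀ x ∈ R, x < maxEntry w := by
  obtain ⟨L, R, hw⟩ := List.append_of_mem (maxEntry_mem h)
  refine ⟨L, R, hw, fun x hx => ?_, fun x hx => ?_⟩
  · refine lt_of_le_of_ne (le_maxEntry (by rw [hw]; simp [hx])) ?_
    rw [hw, List.nodup_append] at hd
    exact hd.2.2 x hx _ (by simp)
  · refine lt_of_le_of_ne (le_maxEntry (by rw [hw]; simp [hx])) ?_
    rw [hw, List.nodup_append] at hd
    rintro rfl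
    exact (List.nodup_cons.1 hd.2.1).1 hx

theorem stackSort_eq_append_maxEntry {w : List ℕ} (h : w ≠ []) :
    ∃ v, stackSort w = v ++ [maxEntry w] := by
  rw [stackSort, dif_neg h]
  exact ⟨_, rfl⟩

theorem mem_stackSort {w : List ℕ} {x : ℕ} : x ∈ stackSort w ↔ x ∈ w := (stackSort_perm w).mem_iff

theorem length_stackSort (w : List ℕ) : (stackSort w).length = w.length :=
  (stackSort_perm w).length_eq

theorem nodup_stackSort {w : List ℕ} : (stackSort w).Nodup ↔ w.Nodup := (stackSort_perm w).nodup_iff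

/-- Induction along the decomposition of a word of distinct entries at its largest entry. -/
theorem List.Nodup.stackSort_induction {motive : List ℕ → Prop} (nil : motive [])
    (append_cons : ∀ L m R, (L ++ m :: R).Nodup → (∀ x ∈ L, x < m) → (∀ x ∈ R, x < m) →
      motive L → motive R → motive (L ++ m :: R)) {w : List ℕ} (hw : w.Nodup) : motive w := by
  induction hn : w.length using Nat.strong_induction_on generalizing w with
  | _ n ih =>
    rcases eq_or_ne w [] with rfl | h
    · exact nil
    · obtain ⟨L, R, e, hL, hR⟩ := exists_eq_append_cons_maxEntry h hw
      generalize maxEntry w = m at e hL hR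
      subst e
      have hl : L.length + (R.length + 1) = n := by simpa using hn
      have hd := List.nodup_append.1 hw
      exact append_cons L m R hw hL hR (ih _ (by omega) hd.1 rfl)
        (ih _ (by omega) (List.nodup_cons.1 hd.2.1).2 rfl)

theorem maxEntry_map {φ : ℕ → ℕ} (hφ : StrictMono φ) {w : List ℕ} (h : w ≠ []) :
    maxEntry (w.map φ) = φ (maxEntry w) := by
  refine maxEntry_eq (List.mem_map_of_mem (maxEntry_mem h)) fun x hx => ?_
  obtain ⟨y, hy, rfl⟩ := List.mem_map.1 hx
  exact hφ.monotone (le_maxEntry hy)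

theorem stackSort_map {φ : ℕ → ℕ} (hφ : StrictMono φ) (w : List ℕ) :
    stackSort (w.map φ) = (stackSort w).map φ := by
  induction hn : w.length using Nat.strong_induction_on generalizing w with
  | _ n ih =>
    rcases eq_or_ne w [] with rfl | h
    · simp
    · have hi := List.idxOf_lt_length_of_mem (maxEntry_mem h)
      have hidx : (w.map φ).idxOf (φ (maxEntry w)) = w.idxOf (maxEntry w) := by
        generalize maxEntry w = m
        clear ih hn h hi
        induction w with
        | nil => rfl
        | cons a w ih =>
          rcases eq_or_ne a m with rfl | h
          · simp
          · rw [List.map_cons, List.idxOf_cons_ne _ h, List.idxOf_cons_ne _ (hφ.injective.ne h), ih]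
      rw [stackSort, dif_neg (by simpa using h), maxEntry_map hφ h, hidx, ← List.map_take,
        ← List.map_drop, ih _ (by simp only [List.length_take]; omega) _ rfl,
        ih _ (by simp only [List.length_drop]; omega) _ rfl]
      conv_rhs => rw [stackSort, dif_neg h]
      simp

theorem stackSort_append_singleton {w : List ℕ} {m : ℕ} (h : ∀ x ∈ w, x < m) :
    stackSort (w ++ [m]) = stackSort w ++ [m] := by
  simpa using stackSort_append_cons h (R := []) (by simp)

theorem stackSort_append_range' {w : List ℕ} {m : ℕ} (h : ∀ x ∈ w, x < m) (k : ℕ) :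
    stackSort (w ++ List.range' m k) = stackSort w ++ List.range' m k := by
  induction k with
  | zero => simp
  | succ k ih =>
    rw [List.range'_concat, ← List.append_assoc, stackSort_append_singleton, ih, List.append_assoc]
    intro x hx
    rcases List.mem_append.1 hx with hx | hx
    · have := h x hx
      omega
    · simp at hx
      omega

/-! ### Sizes of fibres -/

theorem drop_range' (a : ℕ) (i k : ℕ) :
    (List.range' a k).drop i = List.range' (a + i) (k - i) := by
  refine List.ext_getElem (by simp) fun j _ _ => ?_
  simp

theorem card_sortPreimage_nil : (sortPreimage []).card = 1 := by
  rw [Finset.card_eq_one]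
  refine ⟨[], ?_⟩
  ext σ
  rw [mem_sortPreimage, Finset.mem_singleton]
  constructor
  · intro h
    exact List.eq_nil_of_length_eq_zero (by rw [← length_stackSort, h]; rfl)
  · rintro rfl
    simp

/-- A preimage has the form L m R with s(L) s(R) = w, so it amounts to a cut of w and a preimage of
each piece. -/
theorem card_sortPreimage_append_singleton {w : List ℕ} {m : ℕ} (hm : ∀ x ∈ w, x < m) :
    (sortPreimage (w ++ [m])).card = ∑ i ∈ Finset.range (w.length + 1),
      (sortPreimage (w.take i)).card * (sortPreimage (w.drop i)).card := by
  simp_rw [← Finset.card_product]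
  rw [← Finset.card_sigma]
  symm
  have key : ∀ {i : ℕ} {p : List ℕ × List ℕ},
      p ∈ sortPreimage (w.take i) ×ˢ sortPreimage (w.drop i) →
      (∀ x ∈ p.1, x < m) ∧ (∀ x ∈ p.2, x < m) := by
    intro i p hp
    simp only [Finset.mem_product, mem_sortPreimage] at hp
    refine ⟨fun x hx => ?_, fun x hx => ?_⟩
    · rw [← mem_stackSort, hp.1] at hx
      exact hm x (List.mem_of_mem_take hx)
    · rw [← mem_stackSort, hp.2] at hx
      exact hm x (List.mem_of_mem_drop hx)
  refine Finset.card_bij (fun x _ => x.2.1 ++ m :: x.2.2) ?_ ?_ ?_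
  · rintro ⟨i, p⟩ hp
    rw [Finset.mem_sigma] at hp
    have hk := key hp.2
    simp only [Finset.mem_product, mem_sortPreimage] at hp
    rw [mem_sortPreimage, stackSort_append_cons hk.1 hk.2, hp.2.1, hp.2.2, List.take_append_drop]
  · rintro ⟨i, p⟩ hp ⟨j, q⟩ hq h
    rw [Finset.mem_sigma] at hp hq
    have hk := key hp.2
    have hl := key hq.2
    simp only [Finset.mem_product, mem_sortPreimage, Finset.mem_range] at hp hq
    obtain ⟨h1, -, h2⟩ := (List.append_cons_inj_of_notMem (fun h => (hk.1 m h).false)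
      (fun h => (hk.2 m h).false)).1 h
    have h3 := hp.2.1
    have h4 := hq.2.1
    dsimp only at h1 h3 h4
    have h5 : i = j := by
      have e := congrArg List.length (h3.symm.trans ((congrArg stackSort h1).trans h4))
      simp only [List.length_take] at e
      omega
    subst h5
    rw [Prod.ext h1 h2]
  · intro σ hσ
    rw [mem_sortPreimage] at hσ
    have hp : σ.Perm (w ++ [m]) := hσ ▸ (stackSort_perm σ).symm
    obtain ⟨L, R, rfl⟩ := List.append_of_mem (hp.mem_iff.2 (by simp : m ∈ w ++ [m]))
    have hLR : (L ++ R).Perm w :=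
      List.Perm.cons_inv ((List.perm_middle.symm.trans hp).trans (List.perm_append_singleton _ _))
    have hL : ∀ x ∈ L, x < m := fun x hx => hm x (hLR.mem_iff.1 (by simp [hx]))
    have hR : ∀ x ∈ R, x < m := fun x hx => hm x (hLR.mem_iff.1 (by simp [hx]))
    rw [stackSort_append_cons hL hR] at hσ
    have hw := List.append_cancel_right hσ
    refine ⟨⟨L.length, L, R⟩, ?_, rfl⟩
    have hlen := hLR.length_eq
    rw [List.length_append] at hlen
    simp only [Finset.mem_sigma, Finset.mem_range, Finset.mem_product, mem_sortPreimage]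
    refine ⟨by omega, ?_, ?_⟩ <;> rw [← hw, ← length_stackSort L]
    · rw [List.take_left]
    · rw [List.drop_left]

/-- Every nonempty word in the image of s ends in its largest entry. -/
theorem card_sortPreimage_append_eq_zero {w : List ℕ} {x y : ℕ} (hy : y ∈ w) (hxy : x < y) :
    (sortPreimage (w ++ [x])).card = 0 := by
  rw [Finset.card_eq_zero, Finset.eq_empty_iff_forall_notMem]
  intro σ hσ
  rw [mem_sortPreimage] at hσ
  have hne : σ ≠ [] := by
    rintro rfl
    simp at hσ
  obtain ⟨v, hv⟩ := stackSort_eq_append_maxEntry hne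
  have hx : maxEntry σ = x := by
    have := hv.symm.trans hσ
    simpa using (List.append_inj_right' this rfl)
  have : y ∈ σ := by
    rw [← mem_stackSort, hσ]
    simp [hy]
  have := le_maxEntry this
  omega

theorem card_sortPreimage_map {φ : ℕ → ℕ} (hφ : StrictMono φ) (w : List ℕ) :
    (sortPreimage (w.map φ)).card = (sortPreimage w).card := by
  symm
  refine Finset.card_bij (fun σ _ => σ.map φ) ?_ ?_ ?_
  · intro σ hσ
    rw [mem_sortPreimage] at hσ ⊢
    rw [stackSort_map hφ, hσ]
  · intro σ _ τ _ h
    exact hφ.injective.list_map h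
  · intro σ hσ
    rw [mem_sortPreimage] at hσ
    have h : (σ.map (Function.invFun φ)).map φ = σ := by
      rw [List.map_map]
      conv_rhs => rw [← List.map_id σ]
      refine List.map_congr_left fun x hx => ?_
      rw [← mem_stackSort, hσ] at hx
      obtain ⟨y, -, rfl⟩ := List.mem_map.1 hx
      exact congrArg φ (Function.leftInverse_invFun hφ.injective y)
    refine ⟨σ.map (Function.invFun φ), ?_, h⟩
    rw [mem_sortPreimage]
    refine hφ.injective.list_map ?_
    rw [← stackSort_map hφ, h, hσ]

theorem card_sortPreimage_range' (a k : ℕ) : (sortPreimage (List.range' a k)).card = catalan k := by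
  induction k using Nat.strong_induction_on generalizing a with
  | _ k ih =>
    cases k with
    | zero => simpa using card_sortPreimage_nil
    | succ k =>
      rw [List.range'_concat, card_sortPreimage_append_singleton, catalan_succ,
        Finset.sum_range, List.length_range']
      · refine Fintype.sum_congr _ _ fun i => ?_
        have hi : (i : ℕ) ≤ k := by omega
        rw [List.take_range'_of_length_ge hi, drop_range', ih _ (by omega), ih _ (by omega)]
      · intro x hx
        simp at hx
        omega

/-- The size of the fibre over `w` followed by `k` larger entries in increasing order. -/
def tailCount (w : List ℕ) (k : ℕ) : ℕ :=
  (sortPreimage (w ++ List.range' (maxEntry w + 1) k)).card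

theorem card_sortPreimage_append_range' {w : List ℕ} {m : ℕ} (hm : ∀ x ∈ w, x < m) (k : ℕ) :
    (sortPreimage (w ++ List.range' m k)).card = tailCount w k := by
  rcases eq_or_ne w [] with rfl | hw
  · simp [tailCount, card_sortPreimage_range']
  · have hM := hm _ (maxEntry_mem hw)
    -- Fixes the entries of `w` and slides the values above its maximum so that the tail starts at
    -- `m`.
    have hφ : StrictMono fun x => if x ≤ maxEntry w then x else x + (m - (maxEntry w + 1)) := by
      intro x y hxy
      dsimp only
      split_ifs <;> omega
    rw [tailCount, ← card_sortPreimage_map hφ (w ++ List.range' (maxEntry w + 1) k), List.map_append]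
    congr 3
    · refine (List.map_id w).symm.trans (List.map_congr_left fun x hx => ?_)
      simp [le_maxEntry hx]
    · refine List.ext_getElem (by simp) fun i _ _ => ?_
      simp only [List.getElem_map, List.getElem_range']
      split_ifs <;> omega

theorem tailCount_zero (w : List ℕ) : tailCount w 0 = (sortPreimage w).card := by
  simp [tailCount]

theorem tailCount_nil (k : ℕ) : tailCount [] k = catalan k := by
  simp [tailCount, card_sortPreimage_range']

theorem tailCount_map {φ : ℕ → ℕ} (hφ : StrictMono φ) (w : List ℕ) (k : ℕ) :
    tailCount (w.map φ) k = tailCount w k := by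
  rcases eq_or_ne w [] with rfl | hw
  · rfl
  · have hψ : StrictMono fun x => if x ≤ maxEntry w then φ x
        else x + φ (maxEntry w) := by
      intro x y hxy
      have h1 := hφ hxy
      dsimp only
      split_ifs with hx hy hy
      · exact h1
      · have := hφ.monotone hx
        omega
      · omega
      · omega
    have h := card_sortPreimage_map hψ (w ++ List.range' (maxEntry w + 1) k)
    rw [tailCount, tailCount, maxEntry_map hφ hw, ← h, List.map_append]
    have h1 : w.map (fun x => if x ≤ maxEntry w then φ x else x + φ (maxEntry w)) = w.map φ :=
      List.map_congr_left fun x hx => by simp [le_maxEntry hx]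
    have h2 : (List.range' (maxEntry w + 1) k).map
        (fun x => if x ≤ maxEntry w then φ x else x + φ (maxEntry w)) =
        List.range' (φ (maxEntry w) + (maxEntry w + 1)) k := by
      refine List.ext_getElem (by simp) fun i _ _ => ?_
      simp only [List.getElem_map, List.getElem_range']
      split_ifs <;> omega
    rw [h1, h2, card_sortPreimage_append_range' (m := φ (maxEntry w) + (maxEntry w + 1)),
      tailCount, maxEntry_map hφ hw]
    intro x hx
    have := le_maxEntry hx
    rw [maxEntry_map hφ hw] at this
    omega

theorem tailCount_append_singleton {w : List ℕ} {m : ℕ} (hm : ∀ x ∈ w, x < m) (k : ℕ) :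
    tailCount (w ++ [m]) k = tailCount w (k + 1) := by
  rw [← card_sortPreimage_append_range' hm, List.range'_succ, tailCount, maxEntry_eq (m := m)]
  · simp
  · simp
  · intro x hx
    rcases List.mem_append.1 hx with hx | hx
    · exact (hm x hx).le
    · simp at hx
      omega

/-- Removing the last tail entry leaves a word to be cut either inside `w`, when the whole tail goes
right, or inside the tail, when the right piece is increasing and contributes a Catalan number. -/
theorem tailCount_succ (w : List ℕ) (k : ℕ) :
    tailCount w (k + 1) = ∑ i ∈ Finset.range w.length,
        (sortPreimage (w.take i)).card * tailCount (w.drop i) k +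
      ∑ j ∈ Finset.range (k + 1), tailCount w j * catalan (k - j) := by
  have hw : ∀ x ∈ w, x < maxEntry w + 1 := fun x hx => Nat.lt_succ_of_le (le_maxEntry hx)
  rw [tailCount, List.range'_concat, ← List.append_assoc, card_sortPreimage_append_singleton,
    List.length_append, List.length_range', add_assoc, Finset.sum_range_add]
  · congr 1
    · refine Finset.sum_congr rfl fun i hi => ?_
      rw [Finset.mem_range] at hi
      rw [List.take_append_of_le_length hi.le, List.drop_append_of_le_length hi.le,
        card_sortPreimage_append_range' fun x hx => hw x (List.mem_of_mem_drop hx)]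
    · refine Finset.sum_congr rfl fun j hj => ?_
      rw [Finset.mem_range] at hj
      rw [List.take_length_add_append, List.drop_length_add_append, List.take_range'_of_length_ge (by omega),
        drop_range', card_sortPreimage_range', card_sortPreimage_append_range' hw]
  · intro x hx
    rcases List.mem_append.1 hx with hx | hx
    · have := hw x hx
      omega
    · simp at hx
      omega

/-! ### The decomposition of fibres along a descent from the largest entry -/

/-- The generating function of `tailCount w`. -/
noncomputable def tailSeries (w : List ℕ) : PowerSeries ℤ :=
  PowerSeries.mk fun k => (tailCount w k : ℤ)

theorem tailSeries_eq (w : List ℕ) : tailSeries w = PowerSeries.C ((sortPreimage w).card : ℤ) +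
    PowerSeries.X * (∑ i ∈ Finset.range w.length,
        PowerSeries.C ((sortPreimage (w.take i)).card : ℤ) * tailSeries (w.drop i) +
      tailSeries w * catalanGF 1) := by
  ext k
  cases k with
  | zero => simp [tailSeries, tailCount_zero]
  | succ k =>
    rw [map_add, PowerSeries.coeff_succ_X_mul, PowerSeries.coeff_C, if_neg k.succ_ne_zero, zero_add,
      map_add, map_sum, PowerSeries.coeff_mul,
      Finset.Nat.sum_antidiagonal_eq_sum_range_succ
        fun i j => PowerSeries.coeff i (tailSeries w) * PowerSeries.coeff j (catalanGF (1 : ℤ))]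
    simp only [PowerSeries.coeff_C_mul, tailSeries, catalanGF, PowerSeries.coeff_mk, one_pow,
      mul_one, tailCount_succ]
    push_cast
    rfl

/-- Both T(P m Q) and x T(P m) T(Q) satisfy the recursion of `tailSeries_eq`. Cuts of P m Q inside P
are handled by induction, the cut right after m gives |s⁻¹(P m)| T(Q), and later proper cuts of P m
Q vanish because their left piece does not end in its maximum m. -/
theorem tailSeries_append_cons {P Q : List ℕ} {m : ℕ} (hP : ∀ x ∈ P, x < m) (hQ : ∀ x ∈ Q, x < m)
    (hQ0 : Q ≠ []) :
    tailSeries (P ++ m :: Q) = PowerSeries.X * tailSeries (P ++ [m]) * tailSeries Q := by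
  induction hn : P.length using Nat.strong_induction_on generalizing P with
  | _ n ih =>
    have hdesc : ∀ R : List ℕ, R ≠ [] → (∀ x ∈ R, x < m) →
        (sortPreimage (P ++ m :: R)).card = 0 := by
      intro R hR hRm
      obtain ⟨R', x, rfl⟩ : ∃ R' x, R = R' ++ [x] :=
        ⟨_, _, (List.dropLast_append_getLast hR).symm⟩
      rw [show P ++ m :: (R' ++ [x]) = (P ++ m :: R') ++ [x] by simp]
      exact card_sortPreimage_append_eq_zero (y := m) (by simp) (hRm x (by simp))
    have h1 := tailSeries_eq (P ++ m :: Q)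
    have h2 := tailSeries_eq (P ++ [m])
    have hle : ∀ i ∈ Finset.range P.length, i + 1 ≤ P.length := fun i hi => by
      rw [Finset.mem_range] at hi
      omega
    have htake : ∀ (R : List ℕ), ∀ i ∈ Finset.range P.length,
        (P ++ R).take (i + 1) = P.take (i + 1) := fun R i hi =>
      List.take_append_of_le_length (hle i hi)
    have hdrop : ∀ (R : List ℕ), ∀ i ∈ Finset.range P.length,
        (P ++ R).drop (i + 1) = P.drop (i + 1) ++ R := fun R i hi =>
      List.drop_append_of_le_length (hle i hi)
    obtain ⟨x, Q', rfl⟩ := List.exists_cons_of_ne_nil hQ0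
    have hl1 : (P ++ m :: x :: Q').length = (P.length + 1) + (1 + Q'.length) := by
      simp only [List.length_append, List.length_cons]
      omega
    have hl2 : (P ++ [m]).length = P.length + 1 := by simp
    have hsum : ∑ i ∈ Finset.range Q'.length,
        PowerSeries.C ((sortPreimage ((P ++ m :: x :: Q').take (P.length + 1 + (1 + i)))).card : ℤ) *
          tailSeries ((P ++ m :: x :: Q').drop (P.length + 1 + (1 + i))) = 0 := by
      refine Finset.sum_eq_zero fun i _ => ?_
      rw [show P.length + 1 + (1 + i) = P.length + (i + 1 + 1) by omega,
        List.take_length_add_append, List.take_succ_cons, hdesc _ (by simp)]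
      · simp
      · exact fun y hy => hQ y (List.mem_of_mem_take hy)
    rw [hl1, Finset.sum_range_add _ (P.length + 1), Finset.sum_range_add _ 1, hsum, Finset.sum_range_one,
      Finset.sum_range_succ', hdesc _ (by simp) hQ,
      Finset.sum_congr rfl fun i hi => by rw [htake _ i hi, hdrop _ i hi,
        ih (P.drop (i + 1)).length (by have := hle i hi; rw [List.length_drop]; omega)
          (fun y hy => hP y (List.mem_of_mem_drop hy)) rfl]] at h1
    rw [hl2, Finset.sum_range_succ',
      Finset.sum_congr rfl fun i hi => by rw [htake _ i hi, hdrop _ i hi]] at h2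
    have e1 : (P ++ m :: x :: Q').take (P.length + 1 + 0) = P ++ [m] := by
      rw [add_zero, List.take_length_add_append]
      rfl
    have e2 : (P ++ m :: x :: Q').drop (P.length + 1 + 0) = x :: Q' := by
      rw [add_zero, List.drop_length_add_append]
      rfl
    simp only [e1, e2, List.take_zero, List.drop_zero, card_sortPreimage_nil, Nat.cast_one, map_one,
      one_mul, Nat.cast_zero, map_zero, zero_add, add_zero] at h1 h2
    have e3 : ∑ i ∈ Finset.range P.length, PowerSeries.C ((sortPreimage (P.take (i + 1))).card : ℤ) *
          (PowerSeries.X * tailSeries (P.drop (i + 1) ++ [m]) * tailSeries (x :: Q')) =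
        PowerSeries.X * tailSeries (x :: Q') * ∑ i ∈ Finset.range P.length,
          PowerSeries.C ((sortPreimage (P.take (i + 1))).card : ℤ) *
            tailSeries (P.drop (i + 1) ++ [m]) := by
      rw [Finset.mul_sum]
      exact Finset.sum_congr rfl fun i _ => by ring
    rw [e3] at h1
    -- The unknown series also occurs on the right, from the cut at 0 (the term x) and from the cuts
    -- inside the tail (the term xC). Its total factor has constant term 1, so it cancels.
    have hne : (1 - PowerSeries.X - PowerSeries.X * catalanGF 1 : PowerSeries ℤ) ≠ 0 := by
      intro h
      simpa using congrArg PowerSeries.constantCoeff h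
    refine mul_left_cancel₀ hne ?_
    linear_combination h1 - PowerSeries.X * tailSeries (x :: Q') * h2

theorem tailCount_append_cons {P Q : List ℕ} {m : ℕ} (hP : ∀ x ∈ P, x < m) (hQ : ∀ x ∈ Q, x < m)
    (hQ0 : Q ≠ []) (l : ℕ) :
    tailCount (P ++ m :: Q) l = ∑ x ∈ Finset.HasAntidiagonal.antidiagonal l,
      (if x.1 = 0 then 0 else tailCount P x.1) * tailCount Q x.2 := by
  -- The entry m serves as the first tail entry of `P`, hence the restriction to positive tail
  -- lengths.
  have h1 : PowerSeries.X * tailSeries (P ++ [m]) =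
      PowerSeries.mk fun i => ((if i = 0 then 0 else tailCount P i : ℕ) : ℤ) := by
    ext i
    cases i with
    | zero => simp
    | succ i => simp [PowerSeries.coeff_succ_X_mul, tailSeries, tailCount_append_singleton hP]
  have h := congrArg (PowerSeries.coeff l) (tailSeries_append_cons hP hQ hQ0)
  rw [h1, PowerSeries.coeff_mul] at h
  simp only [tailSeries, PowerSeries.coeff_mk] at h
  exact_mod_cast h

/-! ### Legal spaces and words avoiding 231 -/

theorem triple_sublist_iff {w : List ℕ} {x y z : ℕ} : [x, y, z].Sublist w ↔
    ∃ i j k : Fin w.length, i < j ∧ j < k ∧ w[i] = x ∧ w[j] = y ∧ w[k] = z := by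
  rw [List.sublist_iff_exists_fin_orderEmbedding_get_eq]
  constructor
  · rintro ⟨f, hf⟩
    refine ⟨f ⟨0, by simp⟩, f ⟨1, by simp⟩, f ⟨2, by simp⟩, f.lt_iff_lt.2 (by simp),
      f.lt_iff_lt.2 (by simp), ?_, ?_, ?_⟩
    · exact (hf ⟨0, by simp⟩).symm
    · exact (hf ⟨1, by simp⟩).symm
    · exact (hf ⟨2, by simp⟩).symm
  · rintro ⟨i, j, k, hij, hjk, rfl, rfl, rfl⟩
    refine ⟨OrderEmbedding.ofStrictMono ![i, j, k] ?_, ?_⟩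
    · rw [Fin.strictMono_iff_lt_succ]
      intro t
      fin_cases t
      · exact hij
      · exact hjk
    · intro t
      fin_cases t <;> rfl

theorem isLegalSpace_iff_sublist {w : List ℕ} {a : ℕ} : IsLegalSpace w a ↔
    ∀ x y z, [x, y, z].Sublist w → z ≤ a → a < x → ¬ x < y := by
  simp only [triple_sublist_iff, IsLegalSpace]
  constructor
  · rintro h x y z ⟨i, j, k, hij, hjk, rfl, rfl, rfl⟩ h1 h2 h3
    exact h ⟨i, j, k, hij, hjk, h1, h2, h3⟩
  · rintro h ⟨i, j, k, hij, hjk, h1, h2, h3⟩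
    exact h _ _ _ ⟨i, j, k, hij, hjk, rfl, rfl, rfl⟩ h1 h2 h3

theorem triple_sublist_append {A B : List ℕ} {x y z : ℕ} : [x, y, z].Sublist (A ++ B) ↔
    [x, y, z].Sublist A ∨ ([x, y].Sublist A ∧ z ∈ B) ∨ (x ∈ A ∧ [y, z].Sublist B) ∨
      [x, y, z].Sublist B := by
  constructor
  · rw [List.sublist_append_iff]
    rintro ⟨l₁, l₂, h, h1, h2⟩
    match l₁, h with
    | [], h =>
      subst h
      simp [h2]
    | [_], h =>
      obtain ⟨rfl, rfl⟩ : x = _ ∧ _ = l₂ := by simpa using h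
      exact .inr (.inr (.inl ⟨by simpa using h1, h2⟩))
    | [_, _], h =>
      obtain ⟨rfl, rfl, rfl⟩ : x = _ ∧ y = _ ∧ _ = l₂ := by simpa using h
      exact .inr (.inl ⟨h1, by simpa using h2⟩)
    | [_, _, _], h =>
      obtain ⟨rfl, rfl, rfl, rfl⟩ : x = _ ∧ y = _ ∧ z = _ ∧ l₂ = [] := by simpa using h
      exact .inl h1
    | _ :: _ :: _ :: _ :: _, h => simp at h
  · rintro (h | ⟨h1, h2⟩ | ⟨h1, h2⟩ | h)
    · exact h.trans (List.sublist_append_left _ _)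
    · simpa using h1.append (List.singleton_sublist.2 h2)
    · simpa using (List.singleton_sublist.2 h1).append h2
    · exact h.trans (List.sublist_append_right _ _)

/-- A forbidden triple across the cut yields one with m in the middle; m cannot be its first entry,
nor its last. -/
theorem isLegalSpace_append_cons {L R : List ℕ} {m a : ℕ} (hL : ∀ x ∈ L, x < m)
    (hR : ∀ x ∈ R, x < m) : IsLegalSpace (L ++ m :: R) a ↔
      IsLegalSpace L a ∧ IsLegalSpace R a ∧ ∀ x ∈ L, ∀ y ∈ R, y ≤ a → x ≤ a := by
  simp only [isLegalSpace_iff_sublist]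
  constructor
  · intro h
    refine ⟨fun x y z hs => h x y z (hs.trans (List.sublist_append_left _ _)), fun x y z hs =>
      h x y z (hs.trans ((List.sublist_cons_self _ _).trans (List.sublist_append_right _ _))),
      fun x hx y hy hya => ?_⟩
    by_contra hxa
    refine h x m y ?_ hya (not_le.1 hxa) (hL x hx)
    simpa using (List.singleton_sublist.2 hx).append
      ((List.singleton_sublist.2 hy).cons_cons m)
  · rintro ⟨h1, h2, h3⟩ x y z hs hza hax hxy
    rcases triple_sublist_append.1 hs with hs | ⟨hs, hz⟩ | ⟨hx, hs⟩ | hs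
    · exact h1 x y z hs hza hax hxy
    · have hx : x ∈ L := hs.subset (by simp)
      rcases List.mem_cons.1 hz with rfl | hz
      · exact absurd (hL x hx) (by omega)
      · exact absurd (h3 x hx z hz hza) (by omega)
    · rcases List.mem_cons.1 (hs.subset (by simp : z ∈ [y, z])) with rfl | hz
      · exact absurd (hL x hx) (by omega)
      · exact absurd (h3 x hx z hz hza) (by omega)
    · rcases List.sublist_cons_iff.1 hs with hs | ⟨r, hr, hs⟩
      · exact h2 x y z hs hza hax hxy
      · obtain ⟨rfl, rfl⟩ : x = m ∧ _ = r := by simpa using hr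
        exact absurd (hR y (hs.subset (by simp))) (by omega)

theorem isLegalSpace_nil (a : ℕ) : IsLegalSpace [] a := by
  rintro ⟨i, -⟩
  exact i.elim0

/-- Both sides obey the same recursion at the largest entry. It turns legality into a property of
s(w): all entries ≤ a precede all entries > a. -/
theorem isLegalSpace_iff_pairwise {w : List ℕ} (hw : w.Nodup) {a : ℕ} :
    IsLegalSpace w a ↔ (stackSort w).Pairwise fun x y => y ≤ a → x ≤ a := by
  refine hw.stackSort_induction (motive := fun w => IsLegalSpace w a ↔
    (stackSort w).Pairwise fun x y => y ≤ a → x ≤ a) (by simp [isLegalSpace_nil]) ?_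
  · intro L m R _ hL hR ihL ihR
    rw [isLegalSpace_append_cons hL hR, stackSort_append_cons hL hR, ihL, ihR,
      List.pairwise_append, List.pairwise_append]
    have h : ∀ x ∈ stackSort L ++ stackSort R, ∀ y ∈ [m], y ≤ a → x ≤ a := by
      intro x hx y hy hya
      rw [List.mem_append, mem_stackSort, mem_stackSort] at hx
      obtain rfl := List.mem_singleton.1 hy
      rcases hx with hx | hx
      · exact (hL x hx).le.trans hya
      · exact (hR x hx).le.trans hya
    simp only [mem_stackSort, List.pairwise_singleton, true_and]
    tauto

/-- `w` has no three entries in the relative order of `231`. -/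
def Avoids231 (w : List ℕ) : Prop := ∀ x y z, [x, y, z].Sublist w → z < x → ¬ x < y

/-- Knuth's criterion. An inversion of s(w) with smaller value y is an illegal space at y, hence a
231 in `w`, and conversely. -/
theorem pairwise_stackSort_iff {w : List ℕ} (hw : w.Nodup) :
    (stackSort w).Pairwise (· < ·) ↔ Avoids231 w := by
  constructor
  · intro h x y z hs hzx
    have h1 : IsLegalSpace w z := by
      rw [isLegalSpace_iff_pairwise hw]
      exact h.imp fun hxy => hxy.le.trans
    exact isLegalSpace_iff_sublist.1 h1 x y z hs le_rfl hzx
  · intro h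
    rw [List.pairwise_iff_forall_sublist]
    intro x y hs
    by_contra hxy
    have hne : x ≠ y := (List.pairwise_iff_forall_sublist.1 (nodup_stackSort.2 hw)) hs
    have h1 : IsLegalSpace w y := by
      rw [isLegalSpace_iff_sublist]
      exact fun a b c hs hc ha => h a b c hs (by omega)
    rw [isLegalSpace_iff_pairwise hw, List.pairwise_iff_forall_sublist] at h1
    have := h1 hs le_rfl
    omega

theorem Avoids231.sublist {v w : List ℕ} (h : Avoids231 w) (hs : v.Sublist w) : Avoids231 v :=
  fun x y z h' => h x y z (h'.trans hs)

theorem avoids231_map {φ : ℕ → ℕ} (hφ : StrictMono φ) {w : List ℕ} :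
    Avoids231 (w.map φ) ↔ Avoids231 w := by
  constructor
  · intro h x y z hs h1 h2
    exact h _ _ _ (by simpa using hs.map φ) (hφ h1) (hφ h2)
  · intro h x y z hs h1 h2
    obtain ⟨l, hl, e⟩ := List.sublist_map_iff.1 hs
    obtain ⟨x', r, rfl, rfl, e₁⟩ := List.map_eq_cons_iff.1 e.symm
    obtain ⟨y', r, rfl, rfl, e₂⟩ := List.map_eq_cons_iff.1 e₁
    obtain ⟨z', r, rfl, rfl, e₃⟩ := List.map_eq_cons_iff.1 e₂
    obtain rfl := List.map_eq_nil_iff.1 e₃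
    exact h _ _ _ hl (hφ.lt_iff_lt.1 h1) (hφ.lt_iff_lt.1 h2)

theorem avoids231_append_singleton {w : List ℕ} {m : ℕ} (hm : ∀ x ∈ w, x < m) :
    Avoids231 (w ++ [m]) ↔ Avoids231 w := by
  refine ⟨fun h => h.sublist (List.sublist_append_left _ _), fun h x y z hs h1 h2 => ?_⟩
  rcases triple_sublist_append.1 hs with hs | ⟨hs', hz⟩ | ⟨hx, hs⟩ | hs
  · exact h x y z hs h1 h2
  · obtain rfl := List.mem_singleton.1 hz
    exact absurd (hm x (hs'.subset List.mem_cons_self)) (by omega)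
  · simpa using hs.length_le
  · simpa using hs.length_le

theorem avoids231_append_range' {w : List ℕ} {m : ℕ} (hm : ∀ x ∈ w, x < m) (k : ℕ) :
    Avoids231 (w ++ List.range' m k) ↔ Avoids231 w := by
  induction k with
  | zero => simp
  | succ k ih =>
    rw [List.range'_concat, ← List.append_assoc, avoids231_append_singleton, ih]
    intro x hx
    rcases List.mem_append.1 hx with hx | hx
    · have := hm x hx
      omega
    · simp at hx
      omega

/-! ### Permutations in one-line notation -/

theorem mem_permsOf {n : ℕ} {w : List ℕ} :
    w ∈ permsOf n ↔ w.Nodup ∧ w.length = n ∧ ∀ x ∈ w, 1 ≤ x ∧ x ≤ n := by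
  rw [permsOf, List.mem_toFinset, List.mem_permutations]
  constructor
  · intro h
    refine ⟨h.nodup_iff.2 List.nodup_range', by simpa using h.length_eq, fun x hx => ?_⟩
    have := h.mem_iff.1 hx
    simp at this
    omega
  · rintro ⟨hd, hl, h⟩
    refine (hd.subperm fun x hx => ?_).perm_of_length_le (by simp [hl])
    have := h x hx
    simp
    omega

theorem mem_iff_of_mem_permsOf {n : ℕ} {w : List ℕ} (hw : w ∈ permsOf n) {x : ℕ} :
    x ∈ w ↔ 1 ≤ x ∧ x ≤ n := by
  rw [permsOf, List.mem_toFinset, List.mem_permutations] at hw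
  rw [hw.mem_iff, List.mem_range'_1]
  omega

theorem mem_stackSortable_two {n : ℕ} {w : List ℕ} :
    w ∈ stackSortable 2 n ↔ w ∈ permsOf n ∧ Avoids231 (stackSort w) := by
  rw [stackSortable, Finset.mem_filter]
  refine and_congr_right fun h => ?_
  rw [← pairwise_stackSort_iff (nodup_stackSort.2 (mem_permsOf.1 h).1)]
  rfl

/-! ### Tails -/

theorem lt_succ_of_mem_permsOf {n : ℕ} {w : List ℕ} (hw : w ∈ permsOf n) : ∀ x ∈ w, x < n + 1 :=
  fun _ hx => Nat.lt_succ_of_le ((mem_iff_of_mem_permsOf hw).1 hx).2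

theorem length_of_mem_permsOf {n : ℕ} {w : List ℕ} (hw : w ∈ permsOf n) : w.length = n :=
  (mem_permsOf.1 hw).2.1

theorem append_range'_mem_permsOf {p i : ℕ} {w : List ℕ} (hl : w.length = p) :
    w ++ List.range' (p + 1) i ∈ permsOf (p + i) ↔ w ∈ permsOf p := by
  simp only [mem_permsOf, List.nodup_append, List.length_append, List.length_range', hl,
    List.mem_append, List.mem_range'_1]
  constructor
  · rintro ⟨⟨h1, -, h2⟩, -, h3⟩
    refine ⟨h1, trivial, fun x hx => ?_⟩
    have := h3 x (.inl hx)
    have h4 : ¬ (p + 1 ≤ x ∧ x < p + 1 + i) := fun h => h2 x hx x h rfl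
    omega
  · rintro ⟨h1, -, h2⟩
    refine ⟨⟨h1, List.nodup_range', fun x hx y hy => ?_⟩, trivial, fun x hx => ?_⟩
    · have := h2 x hx
      omega
    · rcases hx with hx | hx
      · have := h2 x hx
        omega
      · omega

theorem append_range'_mem_stackSortable {p i : ℕ} {w : List ℕ} (hl : w.length = p) :
    w ++ List.range' (p + 1) i ∈ stackSortable 2 (p + i) ↔ w ∈ stackSortable 2 p := by
  rw [mem_stackSortable_two, mem_stackSortable_two, append_range'_mem_permsOf hl]
  refine and_congr_right fun h => ?_
  have hw := lt_succ_of_mem_permsOf h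
  rw [stackSort_append_range' hw,
    avoids231_append_range' fun x hx => hw x (mem_stackSort.1 hx)]

theorem le_tailLength_iff {w : List ℕ} {i : ℕ} : i ≤ tailLength w ↔
    i ≤ w.length ∧ w.drop (w.length - i) = List.range' (w.length - i + 1) i := by
  have key : ∀ {j}, j ≤ w.length →
      ((∀ t : Fin w.length, w.length - j ≤ (t : ℕ) → w[t] = (t : ℕ) + 1) ↔
        w.drop (w.length - j) = List.range' (w.length - j + 1) j) := by
    intro j hj
    constructor
    · intro h
      refine List.ext_getElem (by simp; omega) fun t h1 h2 => ?_
      rw [List.getElem_drop, List.getElem_range']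
      have h3 : w.length - j + t < w.length := by
        rw [List.length_range'] at h2
        omega
      have := h ⟨w.length - j + t, h3⟩ (by simp)
      simp only [Fin.getElem_fin] at this
      rw [this]
      omega
    · intro h t ht
      obtain ⟨t, ht'⟩ := t
      dsimp only at ht
      have h1 : (w.drop (w.length - j))[t - (w.length - j)]? =
          (List.range' (w.length - j + 1) j)[t - (w.length - j)]? := by rw [h]
      rw [List.getElem?_drop, List.getElem?_range' (by omega), Nat.add_sub_cancel' ht,
        List.getElem?_eq_getElem ht', Option.some_inj] at h1
      simp only [Fin.getElem_fin]
      rw [h1]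
      omega
  rw [tailLength]
  constructor
  · intro h
    have hi : i ≤ w.length := h.trans (Nat.findGreatest_le _)
    refine ⟨hi, (key hi).1 fun t ht => ?_⟩
    refine Nat.findGreatest_spec (P := fun ℓ => ∀ i : Fin w.length, w.length - ℓ ≤ (i : ℕ) →
      w[i] = (i : ℕ) + 1) (Nat.zero_le w.length) ?_ t (by omega)
    intro t ht
    have := t.2
    omega
  · rintro ⟨hi, h⟩
    exact Nat.le_findGreatest hi ((key hi).2 h)

theorem tailLength_le (w : List ℕ) : tailLength w ≤ w.length := Nat.findGreatest_le _

theorem tailLength_append_range' {w : List ℕ} {p : ℕ} (hl : w.length = p) (i : ℕ) :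
    tailLength (w ++ List.range' (p + 1) i) = tailLength w + i := by
  have hlen : (w ++ List.range' (p + 1) i).length = p + i := by simp [hl]
  have key : ∀ j ≤ p, (i + j ≤ tailLength (w ++ List.range' (p + 1) i) ↔ j ≤ tailLength w) := by
    intro j hj
    rw [le_tailLength_iff, le_tailLength_iff, hlen, hl, show p + i - (i + j) = p - j by omega,
      List.drop_append_of_le_length (by omega), add_comm i j, ← List.range'_append_1,
      show p - j + 1 + j = p + 1 by omega, List.append_cancel_right_eq]
    exact and_congr_left fun _ => by omega
  refine eq_of_forall_le_iff fun j => ?_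
  rcases le_total j i with hj | hj
  · have := (key 0 (Nat.zero_le _)).2 (Nat.zero_le _)
    omega
  · obtain ⟨k, rfl⟩ := Nat.exists_eq_add_of_le hj
    rcases le_or_gt k p with hk | hk
    · rw [key k hk]
      omega
    · have h1 := tailLength_le w
      have h2 := tailLength_le (w ++ List.range' (p + 1) i)
      omega

theorem isLegalSpace_of_le {w : List ℕ} {a : ℕ} (h : ∀ x ∈ w, x ≤ a) : IsLegalSpace w a := by
  rintro ⟨i, -, -, -, -, -, h1, -⟩
  have := h _ (List.getElem_mem i.2)
  simp only [Fin.getElem_fin] at h1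
  omega

theorem isLegalSpace_zero {p : ℕ} {w : List ℕ} (hw : w ∈ permsOf p) : IsLegalSpace w 0 := by
  rintro ⟨-, -, k, -, -, h1, -⟩
  have := ((mem_iff_of_mem_permsOf hw).1 (List.getElem_mem k.2)).1
  simp only [Fin.getElem_fin] at h1
  omega

theorem leg_eq_sum (w : List ℕ) :
    leg w = ∑ a ∈ Finset.range (w.length + 1), if IsLegalSpace w a then 1 else 0 := by
  rw [leg, Finset.card_filter]

theorem leg_pos {p : ℕ} {w : List ℕ} (hw : w ∈ permsOf p) : 0 < leg w :=
  Finset.card_pos.2 ⟨0, by simp [isLegalSpace_zero hw]⟩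

/-- Appending the tail leaves the stack-sorted prefix in place, so old spaces keep their status, and
the i new ones lie above all of `w` and are legal. -/
theorem leg_append_range' {p : ℕ} {w : List ℕ} (hw : w ∈ permsOf p) (i : ℕ) :
    leg (w ++ List.range' (p + 1) i) = leg w + i := by
  have hl := length_of_mem_permsOf hw
  have hlt := lt_succ_of_mem_permsOf hw
  have hd : (w ++ List.range' (p + 1) i).Nodup :=
    (mem_permsOf.1 ((append_range'_mem_permsOf hl).2 hw)).1
  have key : ∀ a, IsLegalSpace (w ++ List.range' (p + 1) i) a ↔ IsLegalSpace w a := by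
    intro a
    rw [isLegalSpace_iff_pairwise hd, isLegalSpace_iff_pairwise (mem_permsOf.1 hw).1,
      stackSort_append_range' hlt, List.pairwise_append]
    refine and_iff_left ⟨?_, fun x hx y hy hya => ?_⟩
    · exact (List.pairwise_lt_range' (step := 1)).imp fun h1 h2 => h1.le.trans h2
    · have := hlt x (mem_stackSort.1 hx)
      rw [List.mem_range'_1] at hy
      omega
  rw [leg_eq_sum, leg_eq_sum, List.length_append, List.length_range', hl,
    show p + i + 1 = p + 1 + i by omega, Finset.sum_range_add]
  simp only [key]
  congr 1
  rw [Finset.sum_congr rfl fun a _ => if_pos (isLegalSpace_of_le fun x hx => by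
    have := hlt x hx
    omega)]
  simp

/-- Marking a tail of length i in a permutation of size n is the same as choosing the prefix, a
2-stack-sortable permutation of size n - i. -/
theorem sum_stackSortable_sum_tailLength {M : Type*} [AddCommMonoid M] (n : ℕ)
    (F : List ℕ → ℕ → M) :
    ∑ w ∈ stackSortable 2 n, ∑ i ∈ Finset.range (tailLength w + 1), F w i =
      ∑ x ∈ Finset.HasAntidiagonal.antidiagonal n, ∑ w ∈ stackSortable 2 x.1,
        F (w ++ List.range' (x.1 + 1) x.2) x.2 := by
  have hlen : ∀ {n w}, w ∈ stackSortable 2 n → w.length = n := fun h =>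
    length_of_mem_permsOf (mem_stackSortable_two.1 h).1
  rw [Finset.sum_sigma', Finset.sum_sigma']
  symm
  refine Finset.sum_bij (fun x _ => ⟨x.2 ++ List.range' (x.1.1 + 1) x.1.2, x.1.2⟩) ?_ ?_ ?_ ?_
  · rintro ⟨⟨p, i⟩, w⟩ h
    simp only [Finset.mem_sigma, Finset.HasAntidiagonal.mem_antidiagonal] at h
    obtain ⟨rfl, h⟩ := h
    simp only [Finset.mem_sigma, Finset.mem_range]
    rw [append_range'_mem_stackSortable (hlen h), tailLength_append_range' (hlen h)]
    exact ⟨h, by omega⟩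
  · rintro ⟨⟨p, i⟩, w⟩ h ⟨⟨q, j⟩, v⟩ h' e
    simp only [Finset.mem_sigma, Finset.HasAntidiagonal.mem_antidiagonal] at h h'
    simp only [Sigma.mk.injEq, heq_eq_eq] at e
    obtain ⟨e, rfl⟩ := e
    obtain rfl : p = q := by omega
    rw [List.append_cancel_right e]
  · rintro ⟨w, i⟩ h
    simp only [Finset.mem_sigma, Finset.mem_range, Nat.lt_succ_iff] at h
    obtain ⟨h, hi⟩ := h
    obtain ⟨h1, h2⟩ := le_tailLength_iff.1 hi
    have hl := hlen h
    rw [hl] at h1 h2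
    have e : w.take (n - i) ++ List.range' (n - i + 1) i = w := by
      rw [← h2, List.take_append_drop]
    refine ⟨⟨(n - i, i), w.take (n - i)⟩, ?_, ?_⟩
    · simp only [Finset.mem_sigma, Finset.HasAntidiagonal.mem_antidiagonal]
      refine ⟨by omega, ?_⟩
      rw [← append_range'_mem_stackSortable (i := i) (by simp [hl]), e]
      convert h using 2
      omega
    · dsimp only
      rw [e]
  · rintro ⟨⟨p, i⟩, w⟩ h
    rfl

theorem sum_stackSortable_eq_sum_tailLength_zero {M : Type*} [AddCommMonoid M] (n : ℕ)
    (F : List ℕ → M) :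
    ∑ w ∈ stackSortable 2 n, F w = ∑ x ∈ Finset.HasAntidiagonal.antidiagonal n,
      ∑ w ∈ (stackSortable 2 x.1).filter (tailLength · = 0),
        F (w ++ List.range' (x.1 + 1) x.2) := by
  -- The indicator marks the whole maximal tail, which leaves a prefix of tail length 0.
  have h := sum_stackSortable_sum_tailLength n fun w i => if i = tailLength w then F w else 0
  simp only [Finset.sum_ite_eq', Finset.mem_range, Nat.lt_succ_self, if_true] at h
  rw [h]
  refine Finset.sum_congr rfl fun x _ => ?_
  rw [Finset.sum_filter]
  refine Finset.sum_congr rfl fun w hw => if_congr ?_ rfl rfl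
  rw [tailLength_append_range' (length_of_mem_permsOf (mem_stackSortable_two.1 hw).1)]
  omega

/-! ### Merging two permutations around a new largest entry -/

/-- The relabelling of `{1, …, p}` that moves `p` up by `b`. -/
def lowShift (p b x : ℕ) : ℕ := if x < p then x else x + b

/-- The relabelling of the positive integers that leaves room below `1` for `p - 1` values and
above `b` for one further value. -/
def highShift (p b y : ℕ) : ℕ := if y ≤ b then y + p - 1 else y + p

theorem strictMono_lowShift (p b : ℕ) : StrictMono (lowShift p b) := by
  intro x y h
  simp only [lowShift]
  split_ifs <;> omega

/-- The condition guards against truncated subtraction: for p = 0 and b > 0 the values 0 and 1 would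
collide. -/
theorem strictMono_highShift {p b : ℕ} (h0 : p = 0 → b = 0) : StrictMono (highShift p b) := by
  intro x y h
  simp only [highShift]
  split_ifs <;> omega

/-- Place the entries of `P` before, and those of `Q` after a new largest entry, in such a way that
all entries from `P` but the largest are smaller than those from `Q`, and the largest entry from `P`
is larger than exactly `b` of those from `Q`. -/
def mergeAt (P Q : List ℕ) (b : ℕ) : List ℕ :=
  P.map (lowShift P.length b) ++ (P.length + Q.length + 1) :: Q.map (highShift P.length b)

/-- The set of the `a` for which `(a, a + 1)` is a legal space for `w`. -/
def legalSpaces (w : List ℕ) : Finset ℕ := (Finset.range (w.length + 1)).filter (IsLegalSpace w)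

theorem card_legalSpaces (w : List ℕ) : (legalSpaces w).card = leg w := rfl

theorem mem_legalSpaces {w : List ℕ} {a : ℕ} :
    a ∈ legalSpaces w ↔ a ≤ w.length ∧ IsLegalSpace w a := by
  rw [legalSpaces, Finset.mem_filter, Finset.mem_range, Nat.lt_succ_iff]

section mergeAt

variable {p q b : ℕ} {P Q : List ℕ}

theorem lowShift_lt (hP : P ∈ permsOf p) (hb : b ≤ q) :
    ∀ x ∈ P.map (lowShift p b), x < p + q + 1 := by
  intro x hx
  obtain ⟨x, hx₀, rfl⟩ := List.mem_map.1 hx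
  have := (mem_iff_of_mem_permsOf hP).1 hx₀
  simp only [lowShift]
  split_ifs <;> omega

theorem highShift_lt (hQ : Q ∈ permsOf q) :
    ∀ x ∈ Q.map (highShift p b), x < p + q + 1 := by
  intro x hx
  obtain ⟨x, hx₀, rfl⟩ := List.mem_map.1 hx
  have := (mem_iff_of_mem_permsOf hQ).1 hx₀
  simp only [highShift]
  split_ifs <;> omega

theorem mergeAt_eq (hP : P ∈ permsOf p) (hQ : Q ∈ permsOf q) :
    mergeAt P Q b = P.map (lowShift p b) ++ (p + q + 1) :: Q.map (highShift p b) := by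
  rw [mergeAt, length_of_mem_permsOf hP, length_of_mem_permsOf hQ]

theorem mergeAt_mem_permsOf (hP : P ∈ permsOf p) (hQ : Q ∈ permsOf q) (hb : b ≤ q)
    (h0 : p = 0 → b = 0) : mergeAt P Q b ∈ permsOf (p + q + 1) := by
  have h1 := lowShift_lt hP hb
  have h2 := highShift_lt (p := p) (b := b) hQ
  rw [mergeAt_eq hP hQ, mem_permsOf, List.nodup_append, List.nodup_cons]
  refine ⟨⟨(mem_permsOf.1 hP).1.map (strictMono_lowShift p b).injective,
    ⟨fun h => (h2 _ h).false, (mem_permsOf.1 hQ).1.map (strictMono_highShift h0).injective⟩,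
    fun x hx y hy => ?_⟩, ?_, fun x hx => ?_⟩
  · rcases List.mem_cons.1 hy with rfl | hy
    · exact (h1 x hx).ne
    · obtain ⟨x, hx₀, rfl⟩ := List.mem_map.1 hx
      obtain ⟨y, hy₀, rfl⟩ := List.mem_map.1 hy
      have hx' := (mem_iff_of_mem_permsOf hP).1 hx₀
      have hy' := (mem_iff_of_mem_permsOf hQ).1 hy₀
      simp only [lowShift, highShift]
      split_ifs <;> omega
  · simp [length_of_mem_permsOf hP, length_of_mem_permsOf hQ]
    omega
  · rcases List.mem_append.1 hx with hx | hx
    · have h3 := h1 x hx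
      obtain ⟨x, hx₀, rfl⟩ := List.mem_map.1 hx
      have hx' := (mem_iff_of_mem_permsOf hP).1 hx₀
      simp only [lowShift] at h3 ⊢
      split_ifs at h3 ⊢ <;> omega
    · rcases List.mem_cons.1 hx with rfl | hx
      · omega
      · have h3 := h2 x hx
        obtain ⟨x, hx₀, rfl⟩ := List.mem_map.1 hx
        have hx' := (mem_iff_of_mem_permsOf hQ).1 hx₀
        simp only [highShift] at h3 ⊢
        split_ifs at h3 ⊢ <;> omega

theorem tailLength_eq_zero_of_append_singleton {w : List ℕ} {x : ℕ} (h : x ≤ w.length) :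
    tailLength (w ++ [x]) = 0 := by
  by_contra h0
  have h1 := (le_tailLength_iff.1 (Nat.one_le_iff_ne_zero.2 h0)).2
  simp only [List.length_append, List.length_singleton, Nat.add_sub_cancel, List.drop_left,
    List.range'_one, List.cons.injEq, and_true] at h1
  omega

theorem tailLength_mergeAt (hP : P ∈ permsOf p) (hQ : Q ∈ permsOf q) (hq : q ≠ 0) :
    tailLength (mergeAt P Q b) = 0 := by
  have h1 := highShift_lt (p := p) (b := b) hQ
  rw [mergeAt_eq hP hQ]
  have hlQ := length_of_mem_permsOf hQ
  have hlP := length_of_mem_permsOf hP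
  have hne : Q.map (highShift p b) ≠ [] := by
    rintro h
    rw [List.map_eq_nil_iff] at h
    rw [h] at hlQ
    exact hq hlQ.symm
  have hlen : (Q.map (highShift p b)).length = q := by simp [hlQ]
  obtain ⟨R, x, hR⟩ : ∃ R x, Q.map (highShift p b) = R ++ [x] :=
    ⟨_, _, (List.dropLast_append_getLast hne).symm⟩
  rw [hR] at h1 hlen ⊢
  rw [← List.cons_append, ← List.append_assoc]
  apply tailLength_eq_zero_of_append_singleton
  have := h1 x (by simp)
  simp only [List.length_append, List.length_nil, List.length_cons, List.length_map,
    hlP] at hlen ⊢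
  omega

theorem tailCount_mergeAt (hP : P ∈ permsOf p) (hQ : Q ∈ permsOf q) (hb : b ≤ q)
    (h0 : p = 0 → b = 0) (hq : q ≠ 0) (l : ℕ) :
    tailCount (mergeAt P Q b) l = ∑ x ∈ Finset.HasAntidiagonal.antidiagonal l,
      (if x.1 = 0 then 0 else tailCount P x.1) * tailCount Q x.2 := by
  have hlQ := length_of_mem_permsOf hQ
  rw [mergeAt_eq hP hQ, tailCount_append_cons (lowShift_lt hP hb) (highShift_lt hQ)]
  · simp only [tailCount_map (strictMono_lowShift p b), tailCount_map (strictMono_highShift h0)]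
  · rintro h
    rw [List.map_eq_nil_iff] at h
    rw [h] at hlQ
    exact hq hlQ.symm

theorem isLegalSpace_map {φ : ℕ → ℕ} (hφ : StrictMono φ) {w : List ℕ} (hw : w.Nodup) {a c : ℕ}
    (h : ∀ x ∈ w, φ x ≤ a ↔ x ≤ c) : IsLegalSpace (w.map φ) a ↔ IsLegalSpace w c := by
  rw [isLegalSpace_iff_pairwise (hw.map hφ.injective), isLegalSpace_iff_pairwise hw,
    stackSort_map hφ, List.pairwise_map]
  refine List.Pairwise.iff_of_mem fun {x y} hx hy => ?_
  rw [h x (mem_stackSort.1 hx), h y (mem_stackSort.1 hy)]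

theorem isLegalSpace_of_lt {w : List ℕ} {a : ℕ} (h : ∀ x ∈ w, a < x) : IsLegalSpace w a := by
  rintro ⟨-, -, k, -, -, h1, -⟩
  have := h _ (List.getElem_mem k.2)
  simp only [Fin.getElem_fin] at h1
  omega

theorem isLegalSpace_mergeAt_of_lt (hP : P ∈ permsOf p) (hQ : Q ∈ permsOf q) (hb : b ≤ q) {a : ℕ}
    (ha : a < p) : IsLegalSpace (mergeAt P Q b) a ↔ IsLegalSpace P a := by
  have hQ' : ∀ y ∈ Q.map (highShift p b), a < y := by
    intro y hy
    obtain ⟨y, hy₀, rfl⟩ := List.mem_map.1 hy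
    have := (mem_iff_of_mem_permsOf hQ).1 hy₀
    simp only [highShift]
    split_ifs <;> omega
  rw [mergeAt_eq hP hQ, isLegalSpace_append_cons (lowShift_lt hP hb) (highShift_lt hQ),
    isLegalSpace_map (c := a) (strictMono_lowShift p b) (mem_permsOf.1 hP).1]
  · refine and_iff_left ⟨isLegalSpace_of_lt hQ', fun x _ y hy hya => ?_⟩
    exact absurd (hQ' y hy) (by omega)
  · intro x hx
    simp only [lowShift]
    split_ifs <;> omega

/-- At most one entry coming from `P`, its maximum p + b, exceeds p + a. It blocks the space exactly
when b > a, since the least entry of `Q` becomes p and follows it. -/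
theorem isLegalSpace_mergeAt_add (hP : P ∈ permsOf p) (hQ : Q ∈ permsOf q) (hb : b ≤ q)
    (h0 : p = 0 → b = 0) {a : ℕ} :
    IsLegalSpace (mergeAt P Q b) (p + a) ↔ b ≤ a ∧ IsLegalSpace Q a := by
  have hP' : IsLegalSpace (P.map (lowShift p b)) (p + a) := by
    rw [isLegalSpace_iff_sublist]
    intro x y z hs _ hx hxy
    obtain ⟨x, hx', rfl⟩ := List.mem_map.1 (hs.subset (by simp : x ∈ [x, y, z]))
    obtain ⟨y, hy', rfl⟩ := List.mem_map.1 (hs.subset (by simp : y ∈ [_, y, z]))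
    have h1 := (mem_iff_of_mem_permsOf hP).1 hx'
    have h2 := (mem_iff_of_mem_permsOf hP).1 hy'
    simp only [lowShift] at hx hxy
    split_ifs at hx hxy <;> omega
  rw [mergeAt_eq hP hQ, isLegalSpace_append_cons (lowShift_lt hP hb) (highShift_lt hQ)]
  have hQ' : b ≤ a → (IsLegalSpace (Q.map (highShift p b)) (p + a) ↔ IsLegalSpace Q a) := by
    intro hba
    refine isLegalSpace_map (strictMono_highShift h0) (mem_permsOf.1 hQ).1 fun y _ => ?_
    simp only [highShift]
    split_ifs <;> omega
  constructor
  · rintro ⟨-, h1, h2⟩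
    have hba : b ≤ a := by
      by_contra hba
      have hp : p ∈ P := (mem_iff_of_mem_permsOf hP).2 (by omega)
      have hq : 1 ∈ Q := (mem_iff_of_mem_permsOf hQ).2 (by omega)
      have := h2 _ (List.mem_map_of_mem hp) _ (List.mem_map_of_mem hq)
      simp only [lowShift, highShift] at this
      split_ifs at this <;> omega
    exact ⟨hba, (hQ' hba).1 h1⟩
  · rintro ⟨hba, h1⟩
    refine ⟨hP', (hQ' hba).2 h1, fun x hx _ _ _ => ?_⟩
    obtain ⟨x, hx', rfl⟩ := List.mem_map.1 hx
    have h1 := (mem_iff_of_mem_permsOf hP).1 hx'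
    simp only [lowShift]
    split_ifs <;> omega

/-- Below p the legal spaces are those of `P` except its top one. From p to p + q they are those of
`Q` from b upwards, b included, and the top space p + q + 1 is always legal. -/
theorem leg_mergeAt (hP : P ∈ permsOf p) (hQ : Q ∈ permsOf q) (hb : b ∈ legalSpaces Q)
    (h0 : p = 0 → b = 0) :
    leg (mergeAt P Q b) = leg P + ((legalSpaces Q).filter (b < ·)).card + 1 := by
  have hlP := length_of_mem_permsOf hP
  have hlQ := length_of_mem_permsOf hQ
  rw [mem_legalSpaces, hlQ] at hb
  have hm := mergeAt_mem_permsOf hP hQ hb.1 h0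
  have hlegP : leg P = ∑ a ∈ Finset.range p, (if IsLegalSpace P a then 1 else 0) + 1 := by
    rw [leg_eq_sum, hlP, Finset.sum_range_succ, if_pos (isLegalSpace_of_le fun x hx =>
      ((mem_iff_of_mem_permsOf hP).1 hx).2)]
  have hlegQ : ((legalSpaces Q).filter (b < ·)).card + 1 =
      ∑ a ∈ Finset.range q, (if b ≤ a ∧ IsLegalSpace Q a then 1 else 0) + 1 := by
    trans ∑ a ∈ Finset.range (q + 1), (if b ≤ a ∧ IsLegalSpace Q a then 1 else 0)
    · rw [← Finset.card_filter, ← Finset.card_insert_of_notMem (a := b) (by simp)]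
      congr 1
      ext a
      simp only [Finset.mem_insert, Finset.mem_filter, mem_legalSpaces, hlQ, Finset.mem_range,
        Nat.lt_succ_iff]
      constructor
      · rintro (rfl | h)
        · exact ⟨hb.1, le_rfl, hb.2⟩
        · exact ⟨h.1.1, h.2.le, h.1.2⟩
      · rintro ⟨h1, h2, h3⟩
        rcases h2.eq_or_lt with rfl | h2
        · exact .inl rfl
        · exact .inr ⟨⟨h1, h3⟩, h2⟩
    · rw [Finset.sum_range_succ, if_pos ⟨hb.1, isLegalSpace_of_le fun x hx =>
        ((mem_iff_of_mem_permsOf hQ).1 hx).2⟩]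
  rw [leg_eq_sum, length_of_mem_permsOf hm, Finset.sum_range_succ, Finset.sum_range_succ,
    Finset.sum_range_add, if_pos (isLegalSpace_of_le fun x hx =>
      ((mem_iff_of_mem_permsOf hm).1 hx).2)]
  have h1 : IsLegalSpace (mergeAt P Q b) (p + q) :=
    (isLegalSpace_mergeAt_add hP hQ hb.1 h0).2 ⟨hb.1, isLegalSpace_of_le fun x hx =>
      ((mem_iff_of_mem_permsOf hQ).1 hx).2⟩
  rw [if_pos h1]
  simp only [isLegalSpace_mergeAt_add hP hQ hb.1 h0]
  have h2 : ∑ a ∈ Finset.range p, (if IsLegalSpace (mergeAt P Q b) a then 1 else 0) =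
      ∑ a ∈ Finset.range p, (if IsLegalSpace P a then 1 else 0) :=
    Finset.sum_congr rfl fun a ha => if_congr
      (isLegalSpace_mergeAt_of_lt hP hQ hb.1 (Finset.mem_range.1 ha)) rfl rfl
  omega

theorem avoids231_stackSort_mergeAt (hP : P ∈ permsOf p) (hQ : Q ∈ permsOf q) (hb : b ≤ q)
    (h0 : p = 0 → b = 0) : Avoids231 (stackSort (mergeAt P Q b)) ↔
      Avoids231 (stackSort P) ∧ Avoids231 (stackSort Q) ∧ IsLegalSpace Q b := by
  have hl := strictMono_lowShift p b
  have hh := strictMono_highShift h0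
  have hlt : ∀ x ∈ (stackSort P).map (lowShift p b) ++ (stackSort Q).map (highShift p b),
      x < p + q + 1 := by
    intro x hx
    rw [← stackSort_map hl, ← stackSort_map hh, List.mem_append, mem_stackSort,
      mem_stackSort] at hx
    exact hx.elim (lowShift_lt hP hb x) (highShift_lt hQ x)
  rw [mergeAt_eq hP hQ, stackSort_append_cons (lowShift_lt hP hb) (highShift_lt hQ),
    stackSort_map hl, stackSort_map hh, avoids231_append_singleton hlt]
  have hmemP : ∀ {x}, x ∈ (stackSort P).map (lowShift p b) → x < p ∨ x = p + b := by
    intro x hx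
    obtain ⟨x, hx₀, rfl⟩ := List.mem_map.1 hx
    have := (mem_iff_of_mem_permsOf hP).1 (mem_stackSort.1 hx₀)
    simp only [lowShift]
    split_ifs <;> omega
  have hmemQ : ∀ {y}, y ∈ (stackSort Q).map (highShift p b) → p ≤ y := by
    intro y hy
    obtain ⟨y, hy₀, rfl⟩ := List.mem_map.1 hy
    have := (mem_iff_of_mem_permsOf hQ).1 (mem_stackSort.1 hy₀)
    simp only [highShift]
    split_ifs <;> omega
  rw [isLegalSpace_iff_pairwise (mem_permsOf.1 hQ).1, List.pairwise_iff_forall_sublist]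
  constructor
  · intro h
    refine ⟨(avoids231_map hl).1 (h.sublist (List.sublist_append_left _ _)),
      (avoids231_map hh).1 (h.sublist (List.sublist_append_right _ _)), ?_⟩
    intro y z hs hz
    by_contra hy
    have hy1 := (mem_iff_of_mem_permsOf hQ).1 (mem_stackSort.1 (hs.subset (by simp : z ∈ [y, z])))
    have hp : p ∈ stackSort P := mem_stackSort.2 ((mem_iff_of_mem_permsOf hP).2 (by omega))
    -- If y > b precedes z ≤ b in s(Q), then p + b, the raised maximum of `P`, lies strictly between
    -- their images and precedes both: a 231.
    refine h _ _ _ (triple_sublist_append.2 (.inr (.inr (.inl ⟨List.mem_map_of_mem hp,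
      hs.map (highShift p b)⟩)))) ?_ ?_ <;>
    · simp only [lowShift, highShift]
      split_ifs <;> omega
  · rintro ⟨h1, h2, h3⟩ x y z hs hzx hxy
    rcases triple_sublist_append.1 hs with hs | ⟨hs, hz⟩ | ⟨hx, hs⟩ | hs
    · exact (avoids231_map hl).2 h1 x y z hs hzx hxy
    · have := hmemP (hs.subset (by simp : x ∈ [x, y]))
      have := hmemP (hs.subset (by simp : y ∈ [x, y]))
      have := hmemQ hz
      omega
    -- Images of entries of `Q` are at least p, so z < x forces x = p + b, and then y and z
    -- contradict the legality of b.
    · have h4 := hmemP hx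
      have h5 := hmemQ (hs.subset (by simp : z ∈ [y, z]))
      obtain ⟨l, hl, e⟩ := List.sublist_map_iff.1 hs
      obtain ⟨y', r, rfl, rfl, e₁⟩ := List.map_eq_cons_iff.1 e.symm
      obtain ⟨z', r, rfl, rfl, e₂⟩ := List.map_eq_cons_iff.1 e₁
      obtain rfl := List.map_eq_nil_iff.1 e₂
      have h6 := h3 hl
      simp only [highShift] at hzx hxy h5
      split_ifs at hzx hxy h5 <;> omega
    · exact (avoids231_map hh).2 h2 x y z hs hzx hxy

theorem mergeAt_mem_stackSortable (hP : P ∈ permsOf p) (hQ : Q ∈ permsOf q) (hb : b ≤ q)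
    (h0 : p = 0 → b = 0) : mergeAt P Q b ∈ stackSortable 2 (p + q + 1) ↔
      P ∈ stackSortable 2 p ∧ Q ∈ stackSortable 2 q ∧ b ∈ legalSpaces Q := by
  simp only [mem_stackSortable_two, mem_legalSpaces, hP, hQ, length_of_mem_permsOf hQ, hb,
    mergeAt_mem_permsOf hP hQ hb h0, avoids231_stackSort_mergeAt hP hQ hb h0, true_and]

end mergeAt

/-! ### Permutations of tail length zero as unique merges -/

theorem mergeAt_injective {p q b p' q' b' : ℕ} {P Q P' Q' : List ℕ} (hP : P ∈ permsOf p)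
    (hQ : Q ∈ permsOf q) (hb : b ≤ q) (h0 : p = 0 → b = 0) (hP' : P' ∈ permsOf p')
    (hQ' : Q' ∈ permsOf q') (h0' : p' = 0 → b' = 0) (hn : p + q = p' + q')
    (h : mergeAt P Q b = mergeAt P' Q' b') : P = P' ∧ Q = Q' ∧ b = b' := by
  rw [mergeAt_eq hP hQ, mergeAt_eq hP' hQ'] at h
  rw [hn] at h
  obtain ⟨h1, -, h2⟩ := (List.append_cons_inj_of_notMem
    (fun hx => (hn ▸ lowShift_lt hP hb _ hx).false)
    (fun hx => (hn ▸ highShift_lt hQ _ hx).false)).1 h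
  have hp : p = p' := by
    have := congrArg List.length h1
    simpa [length_of_mem_permsOf hP, length_of_mem_permsOf hP'] using this
  subst hp
  -- The image of p reveals b; for empty `P` the convention b = 0 makes it unique.
  have hbb : b = b' := by
    rcases Nat.eq_zero_or_pos p with hp | hp
    · rw [h0 hp, h0' hp]
    · have h3 : lowShift p b p ∈ P'.map (lowShift p b') :=
        h1 ▸ List.mem_map_of_mem ((mem_iff_of_mem_permsOf hP).2 ⟨hp, le_rfl⟩)
      obtain ⟨x, hx, e⟩ := List.mem_map.1 h3
      have := (mem_iff_of_mem_permsOf hP').1 hx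
      simp only [lowShift] at e
      split_ifs at e <;> omega
  subst hbb
  exact ⟨(strictMono_lowShift p b).injective.list_map h1,
    (strictMono_highShift h0).injective.list_map h2, rfl⟩

/-- Since the non-maximal entries of `P` lie below all of `Q`, counting shows that they are 1, …, p
- 1. The maximum M then exceeds exactly M - p entries of `Q`, which gives b and the inverse
relabellings. -/
theorem exists_mergeAt_eq_of_forall_lt {n : ℕ} {P Q : List ℕ}
    (h : P ++ (n + 1) :: Q ∈ permsOf (n + 1))
    (hlt : ∀ x ∈ P, x ≠ maxEntry P → ∀ z ∈ Q, x < z) :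
    ∃ P' Q' b, P' ∈ permsOf P.length ∧ Q' ∈ permsOf Q.length ∧ b ≤ Q.length ∧
      (P.length = 0 → b = 0) ∧ mergeAt P' Q' b = P ++ (n + 1) :: Q := by
  have hn : P.length + Q.length = n := by
    have := length_of_mem_permsOf h
    simp only [List.length_append, List.length_cons] at this
    omega
  obtain ⟨hdP, hdmQ, hdis⟩ := List.nodup_append.1 (mem_permsOf.1 h).1
  obtain ⟨hmQ, hdQ⟩ := List.nodup_cons.1 hdmQ
  have hmem : ∀ x, x ∈ P ∨ x = n + 1 ∨ x ∈ Q ↔ 1 ≤ x ∧ x ≤ n + 1 := fun x => by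
    rw [← mem_iff_of_mem_permsOf h, List.mem_append, List.mem_cons]
  have hPn : ∀ x ∈ P, 1 ≤ x ∧ x ≤ n := fun x hx => by
    have := (hmem x).1 (.inl hx)
    have := hdis x hx (n + 1) List.mem_cons_self
    omega
  have hQn : ∀ x ∈ Q, 1 ≤ x ∧ x ≤ n := fun x hx => by
    have := (hmem x).1 (.inr (.inr hx))
    have : x ≠ n + 1 := fun e => hmQ (e ▸ hx)
    omega
  rcases eq_or_ne P [] with rfl | hP0
  · have hQ : Q ∈ permsOf Q.length := by
      rw [List.length_nil, zero_add] at hn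
      rw [hn]
      exact mem_permsOf.2 ⟨hdQ, hn, hQn⟩
    refine ⟨[], Q, 0, by simp [mem_permsOf], hQ, Nat.zero_le _, fun _ => rfl, ?_⟩
    simp only [mergeAt, List.length_nil, List.map_nil, List.nil_append, zero_add] at hn ⊢
    rw [hn]
    congr 1
    conv_rhs => rw [← List.map_id Q]
    refine List.map_congr_left fun y _ => ?_
    simp only [highShift, id]
    split_ifs <;> omega
  · have hM := maxEntry_mem hP0
    have hMle : ∀ x ∈ P, x ≤ maxEntry P := fun x hx => le_maxEntry hx
    generalize maxEntry P = M at hlt hM hMle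
    have hcard : (P.toFinset.erase M).card + 1 = P.length := by
      rw [Finset.card_erase_add_one (List.mem_toFinset.2 hM), List.toFinset_card_of_nodup hdP]
    have hlow : ∀ x ∈ P, x ≠ M → x < P.length := by
      intro x hx hxM
      have hs : Finset.Icc 1 x ⊆ P.toFinset.erase M := by
        intro z hz
        rw [Finset.mem_Icc] at hz
        have h1 := hPn x hx
        have h2 := hMle x hx
        rw [Finset.mem_erase, List.mem_toFinset]
        refine ⟨by omega, ?_⟩
        rcases (hmem z).2 ⟨hz.1, by omega⟩ with hz' | hz' | hz'
        · exact hz'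
        · omega
        · have := hlt x hx hxM z hz'
          omega
      have := Finset.card_le_card hs
      rw [Nat.card_Icc] at this
      omega
    have hhigh : ∀ z ∈ Q, P.length ≤ z := by
      intro z hz
      have hs : P.toFinset.erase M ⊆ Finset.Ico 1 z := by
        intro x hx
        rw [Finset.mem_erase, List.mem_toFinset] at hx
        exact Finset.mem_Ico.2 ⟨(hPn x hx.2).1, hlt x hx.2 hx.1 z hz⟩
      have := Finset.card_le_card hs
      rw [Nat.card_Ico] at this
      have := (hQn z hz).1
      omega
    have hMp : P.length ≤ M := by
      have hs : P.toFinset ⊆ Finset.Icc 1 M := by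
        intro x hx
        rw [List.mem_toFinset] at hx
        exact Finset.mem_Icc.2 ⟨(hPn x hx).1, hMle x hx⟩
      have := Finset.card_le_card hs
      rwa [Nat.card_Icc, List.toFinset_card_of_nodup hdP] at this
    have hMn := hPn M hM
    have hp := List.length_pos_of_ne_nil hP0
    have hneM : ∀ y ∈ Q, y ≠ M := fun y hy e =>
      hdis M hM y (List.mem_cons_of_mem _ hy) e.symm
    have e1 : (P.map fun x => if x < P.length then x else P.length).map
        (lowShift P.length (M - P.length)) = P := by
      rw [List.map_map]
      conv_rhs => rw [← List.map_id P]
      refine List.map_congr_left fun x hx => ?_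
      simp only [Function.comp, lowShift, id]
      have h1 := hlow x hx
      by_cases hxM : x = M
      · split_ifs <;> omega
      · have := h1 hxM
        split_ifs
        rfl
    have e2 : (Q.map fun y => if y < M then y + 1 - P.length else y - P.length).map
        (highShift P.length (M - P.length)) = Q := by
      rw [List.map_map]
      conv_rhs => rw [← List.map_id Q]
      refine List.map_congr_left fun y hy => ?_
      simp only [Function.comp, highShift, id]
      have h1 := hneM y hy
      have h2 := hhigh y hy
      split_ifs <;> omega
    refine ⟨P.map fun x => if x < P.length then x else P.length,
      Q.map fun y => if y < M then y + 1 - P.length else y - P.length, M - P.length,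
      mem_permsOf.2 ⟨?_, by simp, ?_⟩, mem_permsOf.2 ⟨?_, by simp, ?_⟩, by omega, by omega, ?_⟩
    · exact List.Nodup.of_map _ (e1.symm ▸ hdP)
    · intro x hx
      obtain ⟨x, hx', rfl⟩ := List.mem_map.1 hx
      have := hPn x hx'
      split_ifs <;> omega
    · exact List.Nodup.of_map _ (e2.symm ▸ hdQ)
    · intro y hy
      obtain ⟨y, hy', rfl⟩ := List.mem_map.1 hy
      have h1 := hQn y hy'
      have h2 := hneM y hy'
      have h3 := hhigh y hy'
      split_ifs <;> omega
    · rw [mergeAt, List.length_map, List.length_map, e1, e2, hn]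

theorem exists_mergeAt_eq {n : ℕ} {w : List ℕ} (hw : w ∈ stackSortable 2 (n + 1))
    (ht : tailLength w = 0) : ∃ p q P Q b, p + q = n ∧ q ≠ 0 ∧ P ∈ stackSortable 2 p ∧
      Q ∈ stackSortable 2 q ∧ b ∈ legalSpaces Q ∧ (p = 0 → b = 0) ∧ mergeAt P Q b = w := by
  have hw' := mem_stackSortable_two.1 hw
  have hmem : ∀ x, x ∈ w ↔ 1 ≤ x ∧ x ≤ n + 1 := fun x => mem_iff_of_mem_permsOf hw'.1
  have hl := length_of_mem_permsOf hw'.1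
  obtain ⟨P, Q, e, hP, hQ⟩ := exists_eq_append_cons_maxEntry
    (List.ne_nil_of_mem ((hmem 1).2 (by omega))) (mem_permsOf.1 hw'.1).1
  rw [maxEntry_eq (m := n + 1) ((hmem _).2 (by omega)) fun x hx => ((hmem x).1 hx).2] at e hP hQ
  have hdis := (List.nodup_append.1 (e ▸ (mem_permsOf.1 hw'.1).1)).2.2
  have hn : P.length + Q.length = n := by
    rw [e, List.length_append, List.length_cons] at hl
    omega
  have hQ0 : Q.length ≠ 0 := by
    intro hQ0
    rw [List.length_eq_zero_iff.1 hQ0] at e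
    have h1 : 1 ≤ tailLength w := by
      rw [le_tailLength_iff, hl]
      refine ⟨by omega, ?_⟩
      have : P.length = n := by omega
      rw [e, Nat.add_sub_cancel, ← this, List.drop_left]
      rfl
    omega
  have hav := hw'.2
  rw [e, stackSort_append_cons hP hQ] at hav
  -- Otherwise x, the maximum of `P` (last in s(P)) and z would form a 231 in s(w).
  have hlt : ∀ x ∈ P, x ≠ maxEntry P → ∀ z ∈ Q, x < z := by
    intro x hx hxM z hz
    by_contra hxz
    have hne := hdis x hx z (List.mem_cons_of_mem _ hz)
    obtain ⟨v, hv⟩ := stackSort_eq_append_maxEntry (List.ne_nil_of_mem hx)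
    have hxv : x ∈ v := by
      have := mem_stackSort.2 hx
      rw [hv, List.mem_append, List.mem_singleton] at this
      exact this.resolve_right hxM
    have hs : [x, maxEntry P].Sublist (stackSort P) := by
      rw [hv]
      simpa using (List.singleton_sublist.2 hxv).append (List.Sublist.refl [maxEntry P])
    have hle := le_maxEntry hx
    refine hav x (maxEntry P) z ((triple_sublist_append.2 (.inr (.inl ⟨hs, mem_stackSort.2 hz⟩))).trans
      (List.sublist_append_left _ _)) (by omega) (by omega)
  obtain ⟨P', Q', b, hP', hQ', hb, h0, h⟩ := exists_mergeAt_eq_of_forall_lt (e ▸ hw'.1) hlt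
  rw [← e] at h
  have h1 : mergeAt P' Q' b ∈ stackSortable 2 (P.length + Q.length + 1) := by
    rw [h, hn]
    exact hw
  obtain ⟨h2, h3, h4⟩ := (mergeAt_mem_stackSortable hP' hQ' hb h0).1 h1
  exact ⟨_, _, P', Q', b, hn, hQ0, h2, h3, h4, h0, h⟩

theorem sum_tailLength_zero_eq_sum_mergeAt {M : Type*} [AddCommMonoid M] (n : ℕ) (F : List ℕ → M) :
    ∑ w ∈ (stackSortable 2 (n + 1)).filter (tailLength · = 0), F w =
      ∑ x ∈ (Finset.HasAntidiagonal.antidiagonal n).filter (·.2 ≠ 0), ∑ P ∈ stackSortable 2 x.1,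
        ∑ Q ∈ stackSortable 2 x.2, ∑ b ∈ (legalSpaces Q).filter fun b => x.1 = 0 → b = 0,
          F (mergeAt P Q b) := by
  rw [Finset.sum_sigma', Finset.sum_sigma', Finset.sum_sigma']
  symm
  have key : ∀ {p q P Q b}, p + q = n → q ≠ 0 → P ∈ stackSortable 2 p → Q ∈ stackSortable 2 q →
      b ∈ legalSpaces Q → (p = 0 → b = 0) → P ∈ permsOf p ∧ Q ∈ permsOf q ∧ b ≤ q := by
    intro p q P Q b _ _ hP hQ hb _
    have hQ' := (mem_stackSortable_two.1 hQ).1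
    refine ⟨(mem_stackSortable_two.1 hP).1, hQ', ?_⟩
    have := (mem_legalSpaces.1 hb).1
    rwa [length_of_mem_permsOf hQ'] at this
  refine Finset.sum_bij (fun x _ => mergeAt x.1.1.2 x.1.2 x.2) ?_ ?_ ?_ fun _ _ => rfl
  · rintro ⟨⟨⟨⟨p, q⟩, P⟩, Q⟩, b⟩ h
    simp only [Finset.mem_sigma, Finset.mem_filter, Finset.HasAntidiagonal.mem_antidiagonal] at h
    obtain ⟨⟨⟨⟨rfl, hq⟩, hP⟩, hQ⟩, hb, h0⟩ := h
    obtain ⟨hP', hQ', hb'⟩ := key rfl hq hP hQ hb h0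
    rw [Finset.mem_filter]
    exact ⟨(mergeAt_mem_stackSortable hP' hQ' hb' h0).2 ⟨hP, hQ, hb⟩,
      tailLength_mergeAt hP' hQ' hq⟩
  · rintro ⟨⟨⟨⟨p, q⟩, P⟩, Q⟩, b⟩ h ⟨⟨⟨⟨p', q'⟩, P'⟩, Q'⟩, b'⟩ h' e
    simp only [Finset.mem_sigma, Finset.mem_filter, Finset.HasAntidiagonal.mem_antidiagonal] at h h'
    obtain ⟨⟨⟨⟨hn, hq⟩, hP⟩, hQ⟩, hb, h0⟩ := h
    obtain ⟨⟨⟨⟨hn', hq'⟩, hP'⟩, hQ'⟩, hb', h0'⟩ := h'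
    obtain ⟨h1, h2, h3⟩ := key hn hq hP hQ hb h0
    obtain ⟨h1', h2', h3'⟩ := key hn' hq' hP' hQ' hb' h0'
    obtain ⟨rfl, rfl, rfl⟩ := mergeAt_injective h1 h2 h3 h0 h1' h2' h0' (hn.trans hn'.symm) e
    obtain rfl : p = p' := (length_of_mem_permsOf h1).symm.trans (length_of_mem_permsOf h1')
    obtain rfl : q = q' := (length_of_mem_permsOf h2).symm.trans (length_of_mem_permsOf h2')
    rfl
  · intro w hw
    rw [Finset.mem_filter] at hw
    obtain ⟨p, q, P, Q, b, hn, hq, hP, hQ, hb, h0, e⟩ := exists_mergeAt_eq hw.1 hw.2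
    refine ⟨⟨⟨⟨⟨p, q⟩, P⟩, Q⟩, b⟩, ?_, e⟩
    simp only [Finset.mem_sigma, Finset.mem_filter, Finset.HasAntidiagonal.mem_antidiagonal]
    exact ⟨⟨⟨⟨hn, hq⟩, hP⟩, hQ⟩, hb, h0⟩

/-- The number of elements above b takes each value 0, …, |S| - 1 once. -/
theorem sum_pow_card_filter_lt {A : Type*} [CommSemiring A] (S : Finset ℕ) (u : A) :
    ∑ b ∈ S, u ^ (S.filter (b < ·)).card = ∑ j ∈ Finset.range S.card, u ^ j := by
  induction S using Finset.induction_on_min with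
  | empty => simp
  | insert a S ha ih =>
    have haS : a ∉ S := fun h => (ha a h).false
    rw [Finset.sum_insert haS, Finset.card_insert_of_notMem haS, Finset.sum_range_succ, ← ih,
      add_comm]
    congr 1
    · refine Finset.sum_congr rfl fun b hb => ?_
      rw [Finset.filter_insert, if_neg (ha b hb).not_gt]
    · rw [Finset.filter_insert, if_neg (lt_irrefl a), Finset.filter_true_of_mem ha]

/-! ### Generating functions -/

section Series

variable {A : Type*} [CommRing A]

/-- The power series whose `n`-th coefficient is `∑_{p + i = n} α p i`. -/
noncomputable def diagSeries (α : ℕ → ℕ → A) : PowerSeries A :=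
  PowerSeries.mk fun n => ∑ x ∈ Finset.HasAntidiagonal.antidiagonal n, α x.1 x.2

/-- Regroups (p + i) + (q + k) as (p + q) + (i + k), that is, from the two marked permutations to
the sizes of the merged word and its tail. -/
theorem coeff_diagSeries_mul (α β : ℕ → ℕ → A) (n : ℕ) :
    PowerSeries.coeff n (diagSeries α * diagSeries β) =
      ∑ x ∈ Finset.HasAntidiagonal.antidiagonal n,
        ∑ y ∈ Finset.HasAntidiagonal.antidiagonal x.1,
          ∑ z ∈ Finset.HasAntidiagonal.antidiagonal x.2, α y.1 z.1 * β y.2 z.2 := by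
  simp only [PowerSeries.coeff_mul, diagSeries, PowerSeries.coeff_mk, Finset.sum_mul_sum]
  simp only [Finset.sum_sigma']
  refine Finset.sum_nbij' (fun x => ⟨(x.2.1.1 + x.2.2.1, x.2.1.2 + x.2.2.2), (x.2.1.1, x.2.2.1),
    (x.2.1.2, x.2.2.2)⟩) (fun x => ⟨(x.2.1.1 + x.2.2.1, x.2.1.2 + x.2.2.2), (x.2.1.1, x.2.2.1),
    (x.2.1.2, x.2.2.2)⟩) ?_ ?_ ?_ ?_ ?_
  · rintro ⟨⟨a, b⟩, ⟨p, i⟩, ⟨q, k⟩⟩ h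
    simp only [Finset.mem_sigma, Finset.HasAntidiagonal.mem_antidiagonal] at h ⊢
    obtain ⟨h1, h2, h3⟩ := h
    refine ⟨?_, trivial, trivial⟩
    omega
  · rintro ⟨⟨a, b⟩, ⟨p, i⟩, ⟨q, k⟩⟩ h
    simp only [Finset.mem_sigma, Finset.HasAntidiagonal.mem_antidiagonal] at h ⊢
    obtain ⟨h1, h2, h3⟩ := h
    refine ⟨?_, trivial, trivial⟩
    omega
  · rintro ⟨⟨a, b⟩, ⟨p, i⟩, ⟨q, k⟩⟩ h
    simp only [Finset.mem_sigma, Finset.HasAntidiagonal.mem_antidiagonal] at h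
    obtain ⟨-, rfl, rfl⟩ := h
    rfl
  · rintro ⟨⟨a, b⟩, ⟨p, i⟩, ⟨q, k⟩⟩ h
    simp only [Finset.mem_sigma, Finset.HasAntidiagonal.mem_antidiagonal] at h
    obtain ⟨-, rfl, rfl⟩ := h
    rfl
  · rintro ⟨⟨a, b⟩, ⟨p, i⟩, ⟨q, k⟩⟩ _
    rfl

theorem diagSeries_add (α β : ℕ → ℕ → A) :
    diagSeries (fun p i => α p i + β p i) = diagSeries α + diagSeries β := by
  ext n
  simp [diagSeries, Finset.sum_add_distrib]

theorem diagSeries_C_mul (c : A) (α : ℕ → ℕ → A) :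
    diagSeries (fun p i => c * α p i) = PowerSeries.C c * diagSeries α := by
  ext n
  simp [diagSeries, Finset.mul_sum]

theorem diagSeries_ite_add (α : ℕ → ℕ → A) :
    diagSeries (fun p i => if p = 0 then 0 else α p i) + PowerSeries.mk (α 0) = diagSeries α := by
  ext n
  simp only [diagSeries, map_add, PowerSeries.coeff_mk]
  cases n with
  | zero => simp
  | succ n =>
    rw [Finset.Nat.antidiagonal_succ, Finset.sum_cons, Finset.sum_cons]
    simp [add_comm]

/-- The generating function of the `2`-stack-sortable permutations of the form `P T`, where `T` is a
marked tail of positive length, which is weighted by one factor `v` less than its length. -/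
def markedTail (u v : A) (p i : ℕ) : A :=
  ∑ P ∈ stackSortable 2 p,
    if i = 0 then 0 else (tailCount P i : A) * u ^ (leg P - 1 + i) * v ^ (i - 1)

/-- The generating function of the `2`-stack-sortable permutations of the form `P T`, where `T` is a
marked tail, which is weighted by a factor `v` for each entry. -/
def markedTail₀ (u v : A) (p i : ℕ) : A :=
  ∑ P ∈ stackSortable 2 p, (tailCount P i : A) * u ^ (leg P - 1 + i) * v ^ i

/-- The generating function of the `2`-stack-sortable permutations of the form `P T`, where `T` is a
marked tail, with a marked legal space of `P`. -/
def markedTailLegal (u v : A) (p i : ℕ) : A :=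
  ∑ P ∈ stackSortable 2 p, (tailCount P i : A) * (u * v) ^ i * ∑ j ∈ Finset.range (leg P), u ^ j

/-! ### Contributions of the empty permutation -/

theorem permsOf_zero : permsOf 0 = {[]} := by
  ext w
  rw [mem_permsOf, List.length_eq_zero_iff, Finset.mem_singleton]
  refine ⟨fun h => h.2.1, ?_⟩
  rintro rfl
  simp

theorem stackSortable_two_zero : stackSortable 2 0 = {[]} := by
  ext w
  rw [mem_stackSortable_two, permsOf_zero, Finset.mem_singleton]
  refine and_iff_left_of_imp ?_
  rintro rfl x y z h
  simp at h

theorem leg_nil : leg [] = 1 := by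
  rw [leg_eq_sum]
  simp [isLegalSpace_nil]

theorem mk_markedTail_zero (u v : A) :
    PowerSeries.C v * PowerSeries.mk (markedTail u v 0) = catalanGF (u * v) - 1 := by
  ext n
  rw [PowerSeries.coeff_C_mul, PowerSeries.coeff_mk, markedTail, stackSortable_two_zero,
    Finset.sum_singleton, leg_nil, tailCount_nil, map_sub, catalanGF, PowerSeries.coeff_mk,
    PowerSeries.coeff_one]
  cases n with
  | zero => simp
  | succ n =>
    simp
    ring

theorem mk_markedTail₀_zero (u v : A) :
    PowerSeries.mk (markedTail₀ u v 0) = catalanGF (u * v) := by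
  ext n
  rw [PowerSeries.coeff_mk, markedTail₀, stackSortable_two_zero, Finset.sum_singleton, leg_nil,
    tailCount_nil, catalanGF, PowerSeries.coeff_mk]
  simp
  ring

theorem mk_markedTailLegal_zero (u v : A) :
    PowerSeries.mk (markedTailLegal u v 0) = catalanGF (u * v) := by
  ext n
  rw [PowerSeries.coeff_mk, markedTailLegal, stackSortable_two_zero, Finset.sum_singleton, leg_nil,
    tailCount_nil, catalanGF, PowerSeries.coeff_mk]
  simp

/-- The added 1 is the empty permutation, absent from J, whose weight is 1 because its `leg` is 1
and its fibre has one element. -/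
theorem seriesJ_add_one (a b : A) : seriesJ a b + 1 = PowerSeries.mk (coeffJ a b) := by
  ext n
  rw [map_add, seriesJ, PowerSeries.coeff_mk, PowerSeries.coeff_mk, PowerSeries.coeff_one]
  split_ifs with h
  · subst h
    have h0 : tailLength [] = 0 := Nat.le_zero.1 (tailLength_le [])
    simp [coeffJ, stackSortable_two_zero, card_sortPreimage_nil, leg_nil, h0]
  · rw [add_zero]

/-- Marking tails of lengths 0, …, tl(w) gives the geometric sum (1 - v^(tl(w) + 1)) / (1 - v) for
each `w`. -/
theorem diagSeries_markedTail₀ (u v : A) : PowerSeries.C (1 - v) * diagSeries (markedTail₀ u v) =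
    seriesJ u 1 + 1 - PowerSeries.C v * (seriesJ u v + 1) := by
  rw [seriesJ_add_one, seriesJ_add_one]
  ext n
  rw [PowerSeries.coeff_C_mul, map_sub, PowerSeries.coeff_C_mul, diagSeries, PowerSeries.coeff_mk,
    PowerSeries.coeff_mk, PowerSeries.coeff_mk]
  have h := sum_stackSortable_sum_tailLength n
    fun w i => ((sortPreimage w).card : A) * u ^ (leg w - 1) * v ^ i
  trans (1 - v) * ∑ w ∈ stackSortable 2 n, ∑ i ∈ Finset.range (tailLength w + 1),
    ((sortPreimage w).card : A) * u ^ (leg w - 1) * v ^ i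
  · rw [h]
    refine congrArg _ (Finset.sum_congr rfl fun x _ => Finset.sum_congr rfl fun P hP => ?_)
    have hP' := (mem_stackSortable_two.1 hP).1
    rw [card_sortPreimage_append_range' (lt_succ_of_mem_permsOf hP'), leg_append_range' hP',
      Nat.sub_add_comm (leg_pos hP')]
  · rw [coeffJ, coeffJ, Finset.mul_sum, Finset.mul_sum, ← Finset.sum_sub_distrib]
    refine Finset.sum_congr rfl fun w _ => ?_
    rw [← Finset.mul_sum]
    linear_combination ((sortPreimage w).card : A) * u ^ (leg w - 1) *
      mul_neg_geom_sum v (tailLength w + 1)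

theorem diagSeries_markedTail (u v : A) : PowerSeries.C (1 - v) * diagSeries (markedTail u v) =
    seriesJ u 1 - seriesJ u v := by
  rw [← add_sub_add_right_eq_sub (seriesJ u 1) (seriesJ u v) 1, seriesJ_add_one, seriesJ_add_one]
  ext n
  rw [PowerSeries.coeff_C_mul, map_sub, diagSeries, PowerSeries.coeff_mk,
    PowerSeries.coeff_mk, PowerSeries.coeff_mk]
  have h := sum_stackSortable_sum_tailLength n
    fun w i => if i = 0 then 0 else ((sortPreimage w).card : A) * u ^ (leg w - 1) * v ^ (i - 1)
  trans (1 - v) * ∑ w ∈ stackSortable 2 n, ∑ i ∈ Finset.range (tailLength w + 1),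
    if i = 0 then 0 else ((sortPreimage w).card : A) * u ^ (leg w - 1) * v ^ (i - 1)
  · rw [h]
    refine congrArg _ (Finset.sum_congr rfl fun x _ => Finset.sum_congr rfl fun P hP => ?_)
    have hP' := (mem_stackSortable_two.1 hP).1
    rw [card_sortPreimage_append_range' (lt_succ_of_mem_permsOf hP'), leg_append_range' hP',
      Nat.sub_add_comm (leg_pos hP')]
  · rw [coeffJ, coeffJ, Finset.mul_sum, ← Finset.sum_sub_distrib]
    refine Finset.sum_congr rfl fun w _ => ?_
    rw [Finset.sum_range_succ']
    simp only [Nat.add_eq_zero_iff, one_ne_zero, and_false, if_false, if_true,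
      Nat.add_sub_cancel, one_pow]
    rw [← Finset.mul_sum]
    linear_combination ((sortPreimage w).card : A) * u ^ (leg w - 1) *
      mul_neg_geom_sum v (tailLength w)

/-- Follows from (1 - u)(1 + u + ... + u^(leg P - 1)) = 1 - u^(leg P), applied for each `P`. -/
theorem diagSeries_markedTailLegal (u v : A) :
    PowerSeries.C (1 - u) * diagSeries (markedTailLegal u v) =
      diagSeries (markedTail₀ 1 (u * v)) - PowerSeries.C u * diagSeries (markedTail₀ u v) := by
  rw [eq_sub_iff_add_eq, ← diagSeries_C_mul, ← diagSeries_C_mul, ← diagSeries_add]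
  congr 1
  ext p i
  rw [markedTailLegal, markedTail₀, markedTail₀, Finset.mul_sum, Finset.mul_sum,
    ← Finset.sum_add_distrib]
  refine Finset.sum_congr rfl fun P hP => ?_
  have hP' := leg_pos (mem_stackSortable_two.1 hP).1
  obtain ⟨k, hk⟩ := Nat.exists_eq_add_of_le' hP'
  rw [one_pow, hk, Nat.add_sub_cancel]
  linear_combination (tailCount P i : A) * (u * v) ^ i * mul_neg_geom_sum u (k + 1)

/-- The Catalan term is the identity. For the rest, the merged word with its tail has weight uv
times a weight of (P, i) and one of (Q, k). Nonempty `P` allows every legal b, whereas empty `P`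
allows only b = 0, which leaves the single power u^(leg Q - 1). -/
theorem coeffJ_succ (u v : A) (n : ℕ) : coeffJ u v (n + 1) =
    (catalan (n + 1) : A) * (u * v) ^ (n + 1) + u * v *
      ∑ x ∈ Finset.HasAntidiagonal.antidiagonal n,
        ∑ y ∈ Finset.HasAntidiagonal.antidiagonal x.1,
          ∑ z ∈ Finset.HasAntidiagonal.antidiagonal x.2,
            ((if y.1 = 0 then 0 else markedTail u v y.1 z.1) *
                (if y.2 = 0 then 0 else markedTailLegal u v y.2 z.2) +
              (if y.1 = 0 then markedTail u v y.1 z.1 else 0) *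
                (if y.2 = 0 then 0 else markedTail₀ u v y.2 z.2)) := by
  have htail : ∀ (N l : ℕ), ∀ w ∈ (stackSortable 2 N).filter (tailLength · = 0),
      ((sortPreimage (w ++ List.range' (N + 1) l)).card : A) *
          u ^ (leg (w ++ List.range' (N + 1) l) - 1) *
          v ^ tailLength (w ++ List.range' (N + 1) l) =
        (tailCount w l : A) * u ^ (leg w + l - 1) * v ^ l := by
    intro N l w hw
    rw [Finset.mem_filter] at hw
    have hw' := (mem_stackSortable_two.1 hw.1).1
    rw [card_sortPreimage_append_range' (lt_succ_of_mem_permsOf hw'), leg_append_range' hw',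
      tailLength_append_range' (length_of_mem_permsOf hw'), hw.2, zero_add]
  rw [coeffJ, sum_stackSortable_eq_sum_tailLength_zero,
    Finset.sum_congr rfl fun x _ => Finset.sum_congr rfl (htail x.1 x.2),
    Finset.Nat.antidiagonal_succ, Finset.sum_cons, Finset.sum_map]
  congr 1
  · have h0 : tailLength [] = 0 := Nat.le_zero.1 (tailLength_le [])
    rw [stackSortable_two_zero, Finset.filter_true_of_mem (by simp [h0]), Finset.sum_singleton,
      leg_nil, tailCount_nil, Nat.add_sub_cancel_left]
    ring
  · rw [Finset.mul_sum]
    refine Finset.sum_congr rfl fun x _ => ?_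
    obtain ⟨N, l⟩ := x
    simp only [Function.Embedding.prodMap, Function.Embedding.coeFn_mk, Prod.map,
      Function.Embedding.refl_apply, Nat.succ_eq_add_one]
    rw [sum_tailLength_zero_eq_sum_mergeAt, Finset.sum_filter, Finset.mul_sum]
    refine Finset.sum_congr rfl fun y _ => ?_
    obtain ⟨p, q⟩ := y
    dsimp only
    rcases eq_or_ne q 0 with rfl | hq
    · simp
    rw [if_pos hq]
    have key : ∀ P ∈ stackSortable 2 p, ∀ Q ∈ stackSortable 2 q,
        ∀ b ∈ (legalSpaces Q).filter fun b => p = 0 → b = 0,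
        (tailCount (mergeAt P Q b) l : A) * u ^ (leg (mergeAt P Q b) + l - 1) * v ^ l =
        ∑ z ∈ Finset.HasAntidiagonal.antidiagonal l, u * v * ((if z.1 = 0 then 0 else
          (tailCount P z.1 : A) * u ^ (leg P - 1 + z.1) * v ^ (z.1 - 1)) *
          ((tailCount Q z.2 : A) * (u * v) ^ z.2 * u ^ ((legalSpaces Q).filter (b < ·)).card)) := by
      intro P hP Q hQ b hb
      rw [Finset.mem_filter] at hb
      have hP' := (mem_stackSortable_two.1 hP).1
      have hQ' := (mem_stackSortable_two.1 hQ).1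
      have hbq := (mem_legalSpaces.1 hb.1).1
      rw [length_of_mem_permsOf hQ'] at hbq
      rw [tailCount_mergeAt hP' hQ' hbq hb.2 hq, leg_mergeAt hP' hQ' hb.1 hb.2]
      push_cast
      rw [Finset.sum_mul, Finset.sum_mul]
      refine Finset.sum_congr rfl fun z hz => ?_
      obtain ⟨i, k⟩ := z
      obtain rfl : i + k = l := Finset.HasAntidiagonal.mem_antidiagonal.1 hz
      cases i with
      | zero => simp
      | succ i =>
        obtain ⟨c, hc⟩ := Nat.exists_eq_succ_of_ne_zero (leg_pos hP').ne'
        simp only [Nat.add_eq_zero_iff, one_ne_zero, and_false, if_false, Nat.add_sub_cancel, hc,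
          Nat.succ_eq_add_one]
        -- With c = leg P - 1, the powers of u come from P with its tail, from the tail of Q, from
        -- the legal spaces above b, and one more from the new maximum.
        rw [show c + 1 + ((legalSpaces Q).filter (b < ·)).card + 1 + (i + 1 + k) - 1 =
          c + (i + 1) + k + ((legalSpaces Q).filter (b < ·)).card + 1 by omega]
        ring
    rw [Finset.sum_congr rfl fun P hP => Finset.sum_congr rfl fun Q hQ =>
      Finset.sum_congr rfl (key P hP Q hQ)]
    simp only [if_neg hq]
    have hswap : ∀ (f : List ℕ → List ℕ → ℕ → ℕ × ℕ → A),
        ∑ P ∈ stackSortable 2 p, ∑ Q ∈ stackSortable 2 q,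
          ∑ b ∈ (legalSpaces Q).filter fun b => p = 0 → b = 0,
            ∑ z ∈ Finset.HasAntidiagonal.antidiagonal l, f P Q b z =
        ∑ z ∈ Finset.HasAntidiagonal.antidiagonal l, ∑ P ∈ stackSortable 2 p,
          ∑ Q ∈ stackSortable 2 q, ∑ b ∈ (legalSpaces Q).filter fun b => p = 0 → b = 0,
            f P Q b z := by
      intro f
      symm
      rw [Finset.sum_comm]
      refine Finset.sum_congr rfl fun P _ => ?_
      rw [Finset.sum_comm]
      exact Finset.sum_congr rfl fun Q _ => Finset.sum_comm
    rw [hswap, Finset.mul_sum]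
    refine Finset.sum_congr rfl fun z _ => ?_
    simp only [← Finset.mul_sum]
    rw [← Finset.sum_mul]
    congr 1
    rcases eq_or_ne p 0 with rfl | hp
    · simp only [if_true, zero_mul, zero_add, true_imp_iff]
      refine congrArg₂ _ rfl (Finset.sum_congr rfl fun Q hQ => ?_)
      have hQ' := (mem_stackSortable_two.1 hQ).1
      have h0 : (0 : ℕ) ∈ legalSpaces Q :=
        mem_legalSpaces.2 ⟨Nat.zero_le _, isLegalSpace_zero hQ'⟩
      -- The space 0 is always legal and is the lowest, so all others lie above it.
      have hcard : ((legalSpaces Q).filter (0 < ·)).card = leg Q - 1 := by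
        rw [← card_legalSpaces, ← Finset.card_erase_of_mem h0]
        congr 1
        ext a
        simp [Nat.pos_iff_ne_zero, and_comm]
      rw [Finset.filter_eq', if_pos h0, Finset.sum_singleton, hcard]
      ring
    · simp only [hp, if_false, zero_mul, add_zero, false_imp_iff, Finset.filter_true]
      refine congrArg₂ _ rfl (Finset.sum_congr rfl fun Q _ => ?_)
      rw [sum_pow_card_filter_lt, card_legalSpaces]

theorem seriesJ_eq (u v : A) : seriesJ u v = catalanGF (u * v) - 1 +
    PowerSeries.X * PowerSeries.C (u * v) *
      (diagSeries (fun p i => if p = 0 then 0 else markedTail u v p i) *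
          diagSeries (fun q k => if q = 0 then 0 else markedTailLegal u v q k) +
        PowerSeries.mk (markedTail u v 0) *
          diagSeries (fun q k => if q = 0 then 0 else markedTail₀ u v q k)) := by
  have h0 : PowerSeries.mk (markedTail u v 0) =
      diagSeries fun p i => if p = 0 then markedTail u v p i else 0 := by
    ext n
    simp only [diagSeries, PowerSeries.coeff_mk]
    cases n with
    | zero => simp
    | succ n =>
      rw [Finset.Nat.antidiagonal_succ, Finset.sum_cons]
      simp
  ext n
  cases n with
  | zero => simp [seriesJ, catalanGF]
  | succ n =>
    rw [h0, mul_assoc, map_add, PowerSeries.coeff_succ_X_mul, PowerSeries.coeff_C_mul, map_add,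
      coeff_diagSeries_mul, coeff_diagSeries_mul, seriesJ, PowerSeries.coeff_mk,
      if_neg n.succ_ne_zero, coeffJ_succ, map_sub, catalanGF, PowerSeries.coeff_mk,
      PowerSeries.coeff_one, if_neg n.succ_ne_zero, sub_zero]
    simp only [Finset.sum_add_distrib]

end Series

/-! ### The functional equation -/

/-- Serves to show that the denominators v, 1 - u, 1 - v and 1 - uv are nonzero, by evaluation at
one point. -/
theorem polyUV_ne {a b : PolyUV} (f : Fin 2 → ℤ)
    (h : MvPolynomial.eval f a ≠ MvPolynomial.eval f b) :
    toField (PowerSeries.C a) ≠ toField (PowerSeries.C b) := by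
  intro e
  refine h (congrArg _ (PowerSeries.C_injective ?_))
  exact IsFractionRing.injective SeriesTUV FieldTUV e

/-- The functional equation for `J`, as an identity in the fraction field of `ℤ[u, v][[t]]`. -/
theorem mainTheorem2 :
    JJ polyU polyV =
      (Ctuv - 1) * (1 + tt * uu * JJ polyU 1)
        + tt * uu * vv / (1 - uu)
          * ((JJ polyU 1 - JJ polyU polyV) / (1 - vv) - (Ctuv - 1) / vv)
          * ((JJ 1 1 - uu * vv * JJ 1 (polyU * polyV)) / (1 - uu * vv)
              - uu * ((JJ polyU 1 - vv * JJ polyU polyV) / (1 - vv))) := by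

  have hv : vv ≠ 0 := by
    simpa using polyUV_ne (a := polyV) (b := 0) (fun _ => 1) (by simp)
  have hu1 : 1 - uu ≠ 0 := by
    rw [sub_ne_zero]
    simpa using polyUV_ne (a := 1) (b := polyU) (fun _ => 0) (by simp)
  have hv1 : 1 - vv ≠ 0 := by
    rw [sub_ne_zero]
    simpa using polyUV_ne (a := 1) (b := polyV) (fun _ => 0) (by simp)
  have huv1 : 1 - uu * vv ≠ 0 := by
    rw [sub_ne_zero]
    simpa using polyUV_ne (a := 1) (b := polyU * polyV) (fun _ => 0) (by simp)
  have hJ := congrArg toField (seriesJ_eq polyU polyV)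
  have hD := congrArg toField (mk_markedTail_zero polyU polyV)
  have hA := congrArg toField (diagSeries_markedTail polyU polyV)
  have hA' := congrArg toField (diagSeries_ite_add (markedTail polyU polyV))
  have hB := congrArg toField (diagSeries_markedTailLegal polyU polyV)
  have hB' := congrArg toField (diagSeries_ite_add (markedTailLegal polyU polyV))
  have hG := congrArg toField (diagSeries_markedTail₀ polyU polyV)
  have hG1 := congrArg toField (diagSeries_markedTail₀ 1 (polyU * polyV))
  have hG' := congrArg toField (diagSeries_ite_add (markedTail₀ polyU polyV))
  rw [mk_markedTailLegal_zero] at hB'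
  rw [mk_markedTail₀_zero] at hG'
  simp only [map_add, map_mul, map_sub, map_one] at hJ hD hA hA' hB hB' hG hG1 hG'
  simp only [JJ, Ctuv, tt, uu, vv] at hv hu1 hv1 huv1 ⊢
  generalize toField (PowerSeries.C polyU) = u at *
  generalize toField (PowerSeries.C polyV) = v at *
  generalize toField PowerSeries.X = t at *
  generalize toField (seriesJ polyU polyV) = J at *
  generalize toField (seriesJ polyU 1) = J₁ at *
  generalize toField (seriesJ 1 (polyU * polyV)) = K at *
  generalize toField (seriesJ 1 1) = K₁ at *
  generalize toField (catalanGF (polyU * polyV)) = C at *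
  generalize toField (diagSeries (markedTail polyU polyV)) = A at *
  generalize toField (diagSeries (markedTailLegal polyU polyV)) = B at *
  generalize toField (diagSeries (markedTail₀ polyU polyV)) = G at *
  generalize toField (diagSeries (markedTail₀ 1 (polyU * polyV))) = G₁ at *
  generalize toField (PowerSeries.mk (markedTail polyU polyV 0)) = D at *
  generalize toField (diagSeries fun p i => if p = 0 then 0 else markedTail polyU polyV p i) = R
    at *
  generalize toField (diagSeries fun q k => if q = 0 then 0 else markedTailLegal polyU polyV q k) =
    S at *
  generalize toField (diagSeries fun q k => if q = 0 then 0 else markedTail₀ polyU polyV q k) = T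
    at *
  have e1 : (J₁ - J) / (1 - v) - (C - 1) / v = R := by
    rw [← hA, ← hD, mul_div_cancel_left₀ _ hv1, mul_div_cancel_left₀ _ hv, ← hA',
      add_sub_cancel_right]
  have e2 : (J₁ - v * J) / (1 - v) = G - 1 := by
    rw [div_eq_iff hv1]
    linear_combination -hG
  have e3 : (K₁ - u * v * K) / (1 - u * v) = G₁ - 1 := by
    rw [div_eq_iff huv1]
    linear_combination -hG1
  have e4 : G - 1 = J₁ + v * A := by
    refine mul_left_cancel₀ hv1 ?_
    linear_combination hG - v * hA
  -- The last factor of the theorem is (1 - u)(B - 1), and its 1 - u cancels the denominator. Here S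
  -- = B - C omits the empty `Q`.
  have e5 : (G₁ - 1 - u * (G - 1)) = (1 - u) * (S + C - 1) := by
    linear_combination -hB + (1 - u) * (-hB')
  rw [e1, e2, e3, e5]
  have e6 : t * u * v / (1 - u) * R * ((1 - u) * (S + C - 1)) =
      t * u * v * R * (S + C - 1) := by
    field_simp
  rw [e6]
  -- Since vD = C - 1 and R = A - D, the series T = G - C equals J₁ + vR. Thus tuvDT splits into the
  -- term with J₁ and the missing tuvR(C - 1).
  linear_combination hJ + t * u * T * hD + t * u * (C - 1) * (hG' + e4 - v * hA' + hD)
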